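/- **Theorem (simulation of sparse-diagonal Lindbladians).** Let $a=(a_{k,l})_{k,l\in\{0,\dots,N-1\}}$ be a matrix of nonnegative real numbers that is $d$-sparse, i.e. each row and each column of $a$ has at most $d$ nonzero entries, and let $$\mathcal L(\rho)=\sum_{k,l=0}^{N-1}a_{k,l}\bigl(2\langle l|\rho|l\rangle\,|k\rangle\langle k|-|l\rangle\langle l|\rho-\rho|l\rangle\langle l|\bigr)$$ be the corresponding diagonal Lindbladian on $N\times N$ matrices. Suppose $a$ is accessible only through a black box that takes a row index or a column index as input and outputs (coherently and reversibly, in $d$ slots in arbitrary order, unused slots being zero) all nonzero entries in that row/column together with their positions. Then $\mathcal L$ can be simulated for any time $t>0$ within error $\epsilon>0$, in diamond norm, using $$O\Bigl(\Bigl(d^2+\frac{d^{5}\tau^{1.5}}{\sqrt{\epsilon}}\Bigr)\log N\Bigr)\ \text{2-qubit gates and}\quad O\Bigl(d^2+\frac{d^{5}\tau^{1.5}}{\sqrt{\epsilon}}\Bigr)\ \text{queries},\qquad \tau:=\|\mathcal L\|_\diamond t .$$ Precisely: there is a universal constant $C>0$ such that for all $N\ge1$, $d\ge0$, $t>0$,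 $\tau\ge0$ and $\epsilon>0$ there is a quantum circuit, not depending on $a$, with at most $C\,(d^2+d^5\tau^{1.5}/\sqrt\epsilon)\log N$ gates and at most $C\,(d^2+d^5\tau^{1.5}/\sqrt\epsilon)$ queries (inverse queries included), such that for every nonnegative $d$-sparse $a$ with $\|\mathcal L\|_\diamond t\le\tau$, and every such black box for $a$, the quantum operation $\mathcal E$ that the circuit implements (ancillas start in the zero state and are discarded at the end) satisfies $\|\mathcal E-e^{t\mathcal L}\|_\diamond<\epsilon$. Here the $N$-dimensional system is stored in $\lceil\log_2N\rceil$ qubits through the binary expansion of the basis labels, so $e^{t\mathcal L}$ is followed by this encoding; the black box writes positions in binary into qubits and adds each entry, as an exact real number, to a register holding a real number; and a gate is an arbitrary unitary on two qubits, or a unitary on one qubit controlled by the content of one real register. The diamond norm is $\|T\|_\diamond=\max\{\|(T\otimes\mathrm{id})(X)\|_1:\|X\|_1=1\}$, where $\mathrm{id}$ acts on a copy of the input space of $T$ and $\|\cdot\|_1$ is the trace norm (sum of singular values). -/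

import Mathlib

open scoped Matrix

noncomputable section

namespace SparseLindblad

/-! ### Superoperators, diamond norm, diagonal Lindbladians -/

/-- The trace norm: the sum of the singular values of `X`, that is, of the square roots of the
eigenvalues of `Xᴴ * X`. -/
def traceNorm {ι : Type*} [Fintype ι] [DecidableEq ι] (X : Matrix ι ι ℂ) : ℝ :=
  ∑ i, √((Matrix.isHermitian_conjTranspose_mul_self X).eigenvalues i)

/-- The ampliation `T ⊗ id` of a superoperator `T`, the identity acting on a second tensor factor
which is a copy of the input space of `T`. -/
def ampliate {m n : Type*} (T : Matrix m m ℂ →ₗ[ℂ] Matrix n n ℂ) (X : Matrix (m × m) (m × m) ℂ) :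
    Matrix (n × m) (n × m) ℂ :=
  fun i j => T (fun k l => X (k, i.2) (l, j.2)) i.1 j.1

/-- The diamond norm `max { ‖(T ⊗ id) X‖₁ : ‖X‖₁ = 1 }`. -/
def diamondNorm {m n : Type*} [Fintype m] [DecidableEq m] [Fintype n] [DecidableEq n]
    (T : Matrix m m ℂ →ₗ[ℂ] Matrix n n ℂ) : ℝ :=
  sSup ((fun X : Matrix (m × m) (m × m) ℂ => traceNorm (ampliate T X)) '' {X | traceNorm X = 1})

/-- The diagonal Lindbladian with coefficient matrix `a`,
`ρ ↦ ∑ k l, a k l (2 ⟨l|ρ|l⟩ |k⟩⟨k| - |l⟩⟨l| ρ - ρ |l⟩⟨l|)`. -/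
def lindbladian {N : ℕ} (a : Matrix (Fin N) (Fin N) ℝ) :
    Matrix (Fin N) (Fin N) ℂ →ₗ[ℂ] Matrix (Fin N) (Fin N) ℂ where
  toFun ρ := ∑ k, ∑ l, (a k l : ℂ) •
    ((2 * ρ l l) • Matrix.single k k (1 : ℂ) - Matrix.single l l (1 : ℂ) * ρ
      - ρ * Matrix.single l l (1 : ℂ))
  map_add' ρ σ := by
    simp only [← Finset.sum_add_distrib]
    refine Finset.sum_congr rfl fun k _ => Finset.sum_congr rfl fun l _ => ?_
    rw [← smul_add, Matrix.add_apply, mul_add, add_smul, mul_add, add_mul]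
    congr 1
    abel
  map_smul' c ρ := by
    simp only [Finset.smul_sum, RingHom.id_apply]
    refine Finset.sum_congr rfl fun k _ => Finset.sum_congr rfl fun l _ => ?_
    rw [Matrix.smul_apply, smul_eq_mul, mul_left_comm, mul_smul, Matrix.mul_smul,
      Matrix.smul_mul, ← smul_sub, ← smul_sub, smul_comm c]

/-- The evolution `exp (t T)` generated by a superoperator `T`, the exponential being computed on
the matrix of `t T` in the basis of matrix units. -/
def evolution {N : ℕ} (T : Matrix (Fin N) (Fin N) ℂ →ₗ[ℂ] Matrix (Fin N) (Fin N) ℂ) (t : ℝ) :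
    Matrix (Fin N) (Fin N) ℂ →ₗ[ℂ] Matrix (Fin N) (Fin N) ℂ :=
  Matrix.toLin (Matrix.stdBasis ℂ (Fin N) (Fin N)) (Matrix.stdBasis ℂ (Fin N) (Fin N))
    (NormedSpace.exp (LinearMap.toMatrix (Matrix.stdBasis ℂ (Fin N) (Fin N))
      (Matrix.stdBasis ℂ (Fin N) (Fin N)) ((t : ℂ) • T)))

/-- Every row and every column of `a` has at most `d` nonzero entries. -/
def IsSparse {N : ℕ} (d : ℕ) (a : Matrix (Fin N) (Fin N) ℝ) : Prop :=
  (∀ k, {l | a k l ≠ 0}.ncard ≤ d) ∧ (∀ l, {k | a k l ≠ 0}.ncard ≤ d)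

/-! ### The black box -/

/-- The slots `f` contain every position at which `g` is nonzero exactly once, and no other
position; unused slots are `none`. -/
def Lists {N d : ℕ} (g : Fin N → ℝ) (f : Fin d → Option (Fin N)) : Prop :=
  (∀ j l, f j = some l → g l ≠ 0) ∧ ∀ l, g l ≠ 0 → ∃! j, f j = some l

/-- A black box for the `d`-sparse matrix `a`: for every row and every column, a list (in any
order) of the positions of its nonzero entries. -/
structure BlackBox {N : ℕ} (a : Matrix (Fin N) (Fin N) ℝ) (d : ℕ) where
  row : Fin N → Fin d → Option (Fin N)
  col : Fin N → Fin d → Option (Fin N)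
  row_lists : ∀ k, Lists (fun l => a k l) (row k)
  col_lists : ∀ l, Lists (fun k => a k l) (col l)

/-- The number of qubits that hold an index in `{0, …, N - 1}`. -/
abbrev width (N : ℕ) : ℕ := Nat.clog 2 N

/-- The binary expansion of an index. -/
def bits {N : ℕ} (x : Fin N) : Fin (width N) → Bool := fun i => (x : ℕ).testBit i

/-- The content of slot `j` of the answer to a query about the row (`byCol = false`) or the column
(`byCol = true`) with index `x`: the position of a nonzero entry in binary and its value.
Unused slots hold zeros. -/
def BlackBox.answer {N d : ℕ} {a : Matrix (Fin N) (Fin N) ℝ} (B : BlackBox a d) (byCol : Bool)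
    (x : Fin N) (j : Fin d) : (Fin (width N) → Bool) × ℝ :=
  if byCol then
    match B.col x j with
    | some k => (bits k, a k x)
    | none => (fun _ => false, 0)
  else
    match B.row x j with
    | some l => (bits l, a x l)
    | none => (fun _ => false, 0)

/-! ### Circuits

The memory consists of qubits, labelled by `Q`, and of real registers, labelled by `R`. A real
register holds an entry of `a` delivered by the black box, exactly. -/

/-- A computational basis state: a bit for every qubit, a real number for every real register. -/
abbrev Config (Q R : Type) := (Q → Bool) × (R → ℝ)

/-- The elementary operations. -/
inductive Gate (N d : ℕ) (Q R : Type) where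
  /-- a unitary on two distinct qubits `i` and `j` -/
  | pair (i j : Q) (hij : i ≠ j) (U : Matrix.unitaryGroup (Bool × Bool) ℂ) : Gate N d Q R
  /-- a unitary on the qubit `i`, which is controlled by the content of the real register `r` -/
  | ctrl (r : R) (i : Q) (U : ℝ → Matrix.unitaryGroup Bool ℂ) : Gate N d Q R
  /-- a query (or, if `inv`, an inverse query) for the row or column whose index is in the qubits
  `addr`; slot `j` of the answer is added to the qubits `pos (j, ·)` and the register `val j` -/
  | query (byCol inv : Bool) (addr : Fin (width N) ↪ Q) (pos : Fin d × Fin (width N) ↪ Q)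
      (val : Fin d ↪ R) (hdisj : ∀ i p, addr i ≠ pos p) : Gate N d Q R

/-- The effect of a query on a basis state. Positions are added bitwise modulo two, values are added
as real numbers (subtracted in an inverse query). If the address qubits do not hold an index below
`N`, nothing happens. -/
def queryConfig {N d : ℕ} {a : Matrix (Fin N) (Fin N) ℝ} (B : BlackBox a d) {Q R : Type}
    (byCol inv : Bool) (addr : Fin (width N) ↪ Q) (pos : Fin d × Fin (width N) ↪ Q)
    (val : Fin d ↪ R) (c : Config Q R) : Config Q R :=
  open Classical in
  if h : ∃ x : Fin N, bits x = fun i => c.1 (addr i) then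
    (fun z => xor (c.1 z)
        (Function.extend pos (fun p => (B.answer byCol h.choose p.1).1 p.2) (fun _ => false) z),
      fun z => c.2 z + (if inv then -1 else 1) *
        Function.extend val (fun j => (B.answer byCol h.choose j).2) (fun _ => 0) z)
  else c

/-- The image of a basis state under an elementary operation. -/
def Gate.onBasis {N d : ℕ} {a : Matrix (Fin N) (Fin N) ℝ} (B : BlackBox a d) {Q R : Type}
    [DecidableEq Q] (c : Config Q R) : Gate N d Q R → (Config Q R →₀ ℂ)
  | .pair i j _ U => ∑ b : Bool × Bool,
      Finsupp.single (Function.update (Function.update c.1 i b.1) j b.2, c.2)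
        ((U : Matrix (Bool × Bool) (Bool × Bool) ℂ) b (c.1 i, c.1 j))
  | .ctrl r i U => ∑ b : Bool,
      Finsupp.single (Function.update c.1 i b, c.2) ((U (c.2 r) : Matrix Bool Bool ℂ) b (c.1 i))
  | .query byCol inv addr pos val _ => Finsupp.single (queryConfig B byCol inv addr pos val c) 1

/-- The linear extension to superpositions of basis states. -/
def Gate.apply {N d : ℕ} {a : Matrix (Fin N) (Fin N) ℝ} (B : BlackBox a d) {Q R : Type}
    [DecidableEq Q] (g : Gate N d Q R) : (Config Q R →₀ ℂ) →ₗ[ℂ] (Config Q R →₀ ℂ) :=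
  Finsupp.linearCombination ℂ fun c => g.onBasis B c

def Gate.isQuery {N d : ℕ} {Q R : Type} : Gate N d Q R → Bool
  | .query .. => true
  | _ => false

/-- A circuit: its system qubits `Sum.inl i` hold the input and the output, and it may use any
number of ancilla qubits `Sum.inr i` and of real registers, all of which start out as zero. Its
description does not depend on the matrix `a`. -/
structure Circuit (N d : ℕ) where
  ancillas : ℕ
  registers : ℕ
  gates : List (Gate N d (Fin (width N) ⊕ Fin ancillas) (Fin registers))

namespace Circuit

variable {N d : ℕ} (A : Circuit N d)

/-- The number of elementary operations other than queries. -/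
def gateCount : ℕ := A.gates.countP fun g => !g.isQuery

/-- The number of queries, inverse queries included. -/
def queryCount : ℕ := A.gates.countP fun g => g.isQuery

/-- The final state of the whole memory if the system starts out in the basis state `x`. -/
def run {a : Matrix (Fin N) (Fin N) ℝ} (B : BlackBox a d) (x : Fin N) :
    Config (Fin (width N) ⊕ Fin A.ancillas) (Fin A.registers) →₀ ℂ :=
  A.gates.foldl (fun ψ g => g.apply B ψ)
    (Finsupp.single (Sum.elim (bits x) fun _ => false, fun _ => 0) 1)

/-- The partial trace `Tr_anc |ψ⟩⟨φ|` over everything but the system qubits. -/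
def reduced (ψ φ : Config (Fin (width N) ⊕ Fin A.ancillas) (Fin A.registers) →₀ ℂ) :
    Matrix (Fin (width N) → Bool) (Fin (width N) → Bool) ℂ :=
  fun s s' => ψ.sum fun c z =>
    if (fun i => c.1 (Sum.inl i)) = s then
      z * star (φ (Sum.elim s' fun i => c.1 (Sum.inr i), c.2))
    else 0

/-- The quantum operation implemented by the circuit: run it on the input state (extended by
ancillas in state zero) and discard all ancillas at the end. -/
def channel {a : Matrix (Fin N) (Fin N) ℝ} (B : BlackBox a d) :
    Matrix (Fin N) (Fin N) ℂ →ₗ[ℂ] Matrix (Fin (width N) → Bool) (Fin (width N) → Bool) ℂ where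
  toFun ρ := ∑ x, ∑ y, ρ x y • A.reduced (A.run B x) (A.run B y)
  map_add' ρ σ := by
    simp only [Matrix.add_apply, add_smul, Finset.sum_add_distrib]
  map_smul' c ρ := by
    simp only [Matrix.smul_apply, smul_eq_mul, mul_smul, Finset.smul_sum, RingHom.id_apply]

end Circuit

/-- The isometry `|x⟩ ↦ |bits x⟩` that stores the `N`-dimensional system in qubits. -/
def encodeMatrix (N : ℕ) : Matrix (Fin (width N) → Bool) (Fin N) ℂ :=
  fun s x => if s = bits x then 1 else 0

/-- Storing a state of the `N`-dimensional system in qubits. -/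
def encode (N : ℕ) :
    Matrix (Fin N) (Fin N) ℂ →ₗ[ℂ] Matrix (Fin (width N) → Bool) (Fin (width N) → Bool) ℂ where
  toFun ρ := encodeMatrix N * ρ * (encodeMatrix N)ᴴ
  map_add' ρ σ := by rw [Matrix.mul_add, Matrix.add_mul]
  map_smul' c ρ := by rw [Matrix.mul_smul, Matrix.smul_mul, RingHom.id_apply]

end SparseLindblad

end

/-!
A diagonal Lindbladian acts on populations and coherences separately. A coherence between two basis
states `x ≠ y` decays with the rate `S x + S y`, where `S x` is the sum of the column `x` of `a`
(`evolution_lindbladian_single_of_ne`), and the populations follow the classical Markov chain that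
jumps from `x` to `k` with the rate `2 * a k x` (`evolution_lindbladian_single_same`).

The circuit is a sequence of jump attempts, each for one of the `d` slots `j` of the black box.
Querying the column `x` gives a target `k` and a rate `v` in slot `j`, and a rotation sets a flag
with amplitude `√(1 - exp (-2 * v * s))`. If the flag is set, the system moves to `k` and tries a
second move with half of the time; the old positions are kept in fresh ancillas. The flags and
old positions that remain in the ancillas decohere all histories in which a jump occurs. As a
consequence, an attempt multiplies coherences exactly by the amplitudes `exp (-v * s)` for not
jumping, and it moves the populations by a stochastic matrix (`ancillaTrace_exec_attemptsGates`).
The product of the amplitudes over all slots is the exact decay of the coherences, because the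
slots of the column `x` add up to `S x`.

Therefore the whole error sits in the populations (`diamondNorm_channel_jumpCircuit_sub_le`): the
difference of the two operations reads out the diagonal and prepares basis states, so that its
diamond norm is at most a row sum norm of a difference of transition matrices
(`diamondNorm_le_of_classical`). The second move makes each attempt agree with the exponential of
its generator to second order (`secondOrder_attempt`). Running through the slots forwards and then
backwards makes the second order terms of the product agree as well, as in the symmetric Trotter
formula (`norm_palindrome_sub_exp_le`). With rescaled time `τ`, the rate in every slot times `t` is
at most `τ`, because the decay rates of coherences are bounded by the diamond norm
(`sum_le_diamondNorm_lindbladian`). The error of `r` sweeps is `O(r * (d * τ / r) ^ 3)`, hence a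
number `r` of sweeps of order `1 + d ^ 2 * τ ^ (3 / 2) / √ε` suffices. Each sweep consists of
`2 * d` attempts, and each attempt uses four queries and `O(log N)` gates.

For `N = 1` no gates are allowed, and none are needed, as the Lindbladian vanishes.
-/

open scoped Matrix

namespace SparseLindblad

/-! ### Trace norm and diamond norm -/

section TraceNorm

variable {ι : Type*} [Fintype ι] [DecidableEq ι]

/-- The sesquilinear form of `V` is bounded by `η`, i.e. the spectral norm of `V` is at most `η`. -/
def FormBound (V : Matrix ι ι ℂ) (η : ℝ) : Prop :=
  ∀ f g : EuclideanSpace ℂ ι, ‖inner ℂ f (Matrix.toEuclideanLin V g)‖ ≤ η * ‖f‖ * ‖g‖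

theorem inner_toEuclideanLin_eigenvectorBasis (X : Matrix ι ι ℂ) (i j : ι) :
    inner ℂ (Matrix.toEuclideanLin X
        ((Matrix.isHermitian_conjTranspose_mul_self X).eigenvectorBasis i))
      (Matrix.toEuclideanLin X ((Matrix.isHermitian_conjTranspose_mul_self X).eigenvectorBasis j))
      = if i = j then
          (((Matrix.isHermitian_conjTranspose_mul_self X).eigenvalues i : ℝ) : ℂ) else 0 := by
  set hX := Matrix.isHermitian_conjTranspose_mul_self X
  have h1 : ∀ v w : EuclideanSpace ℂ ι,
      inner ℂ (Matrix.toEuclideanLin X v) (Matrix.toEuclideanLin X w)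
        = inner ℂ v (Matrix.toEuclideanLin (Xᴴ * X) w) := by
    intro v w
    rw [Matrix.toLpLin_mul_same, LinearMap.comp_apply,
      Matrix.toEuclideanLin_conjTranspose_eq_adjoint, LinearMap.adjoint_inner_right]
  have h2 : Matrix.toEuclideanLin (Xᴴ * X) (hX.eigenvectorBasis j)
      = ((hX.eigenvalues j : ℝ) : ℂ) • hX.eigenvectorBasis j := by
    have := hX.mulVec_eigenvectorBasis j
    apply (WithLp.equiv 2 _).injective
    simpa using this
  rw [h1, h2, inner_smul_right, orthonormal_iff_ite.mp hX.eigenvectorBasis.orthonormal]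
  split_ifs with h
  · rw [h, mul_one]
  · rw [mul_zero]

theorem norm_toEuclideanLin_eigenvectorBasis (X : Matrix ι ι ℂ) (i : ι) :
    ‖Matrix.toEuclideanLin X ((Matrix.isHermitian_conjTranspose_mul_self X).eigenvectorBasis i)‖
      = √((Matrix.isHermitian_conjTranspose_mul_self X).eigenvalues i) := by
  have h := inner_toEuclideanLin_eigenvectorBasis X i i
  rw [if_pos rfl, inner_self_eq_norm_sq_to_K] at h
  have h' : ‖Matrix.toEuclideanLin X
      ((Matrix.isHermitian_conjTranspose_mul_self X).eigenvectorBasis i)‖ ^ 2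
      = (Matrix.isHermitian_conjTranspose_mul_self X).eigenvalues i :=
    Complex.ofReal_injective ((Complex.ofReal_pow _ 2).trans h)
  rw [eq_comm, Real.sqrt_eq_iff_mul_self_eq]
  · rw [← sq]
    exact h'.symm
  · rw [← h']
    positivity
  · exact norm_nonneg _

theorem trace_mul_eq_sum_inner (V X : Matrix ι ι ℂ)
    (b : OrthonormalBasis ι ℂ (EuclideanSpace ℂ ι)) :
    (V * X).trace = ∑ i, inner ℂ (b i)
      (Matrix.toEuclideanLin V (Matrix.toEuclideanLin X (b i))) := by
  have h1 : (V * X).trace = LinearMap.trace ℂ _ (Matrix.toEuclideanLin (V * X)) := by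
    rw [Matrix.toEuclideanLin_eq_toLin_orthonormal, Matrix.trace_toLin_eq]
  rw [h1, LinearMap.trace_eq_sum_inner _ b]
  simp [Matrix.toLpLin_mul_same]

/-- One half of the duality between trace norm and spectral norm. -/
theorem FormBound.norm_trace_mul_le {V : Matrix ι ι ℂ} {η : ℝ} (hV : FormBound V η)
    (X : Matrix ι ι ℂ) : ‖(V * X).trace‖ ≤ η * traceNorm X := by
  rw [trace_mul_eq_sum_inner V X (Matrix.isHermitian_conjTranspose_mul_self X).eigenvectorBasis,
    traceNorm, Finset.mul_sum]
  refine (norm_sum_le _ _).trans (Finset.sum_le_sum fun i _ => ?_)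
  refine (hV _ _).trans (le_of_eq ?_)
  rw [norm_toEuclideanLin_eigenvectorBasis, OrthonormalBasis.norm_eq_one, mul_one]

/-- The other half of the duality: the trace norm is attained at the adjoint of the partial
isometry of the polar decomposition. -/
theorem exists_formBound_trace_mul_eq (X : Matrix ι ι ℂ) :
    ∃ U : Matrix ι ι ℂ, FormBound U 1 ∧ (U * X).trace = (traceNorm X : ℂ) := by
  classical
  set hX := Matrix.isHermitian_conjTranspose_mul_self X with hXdef
  set b := hX.eigenvectorBasis
  set σ : ι → ℝ := fun i => √(hX.eigenvalues i) with hσ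
  -- The left singular vectors; they vanish where the singular value does.
  set w : ι → EuclideanSpace ℂ ι := fun i =>
    ((σ i : ℂ))⁻¹ • Matrix.toEuclideanLin X (b i) with hw
  have hlam : ∀ i, hX.eigenvalues i = σ i ^ 2 := fun i => by
    have h := norm_toEuclideanLin_eigenvectorBasis X i
    have h1 := inner_toEuclideanLin_eigenvectorBasis X i i
    rw [if_pos rfl, inner_self_eq_norm_sq_to_K] at h1
    have h2 := Complex.ofReal_injective ((Complex.ofReal_pow _ 2).trans h1)
    rw [← h2]
    exact congrArg (· ^ 2) h
  have hww : ∀ i j, inner ℂ (w i) (Matrix.toEuclideanLin X (b j))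
      = if i = j then (σ i : ℂ) else 0 := by
    intro i j
    rw [hw]
    simp only [inner_smul_left]
    rw [inner_toEuclideanLin_eigenvectorBasis]
    split_ifs with h
    · rw [hlam]
      by_cases h0 : σ i = 0
      · simp [h0]
      · have : (σ i : ℂ) ≠ 0 := by exact_mod_cast h0
        simp only [map_inv₀, Complex.conj_ofReal, Complex.ofReal_pow]
        field_simp
    · simp
  have hon : Orthonormal ℂ (fun i : {i // σ i ≠ 0} => w i) := by
    rw [orthonormal_iff_ite]
    intro i j
    have h0 : (σ j : ℂ) ≠ 0 := by exact_mod_cast j.2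
    have : inner ℂ (w i) (w j) = (σ j : ℂ)⁻¹ * inner ℂ (w i) (Matrix.toEuclideanLin X (b j)) := by
      conv_lhs => rw [hw]
      simp only [inner_smul_right]
      rfl
    rw [this, hww]
    by_cases h : i = j
    · simp [h, h0]
    · have : (i : ι) ≠ j := fun h' => h (Subtype.ext h')
      simp [h, this]
  have hbessel : ∀ g, ∑ i, ‖inner ℂ (w i) g‖ ^ 2 ≤ ‖g‖ ^ 2 := by
    intro g
    refine le_trans (le_of_eq ?_) (hon.sum_inner_products_le g (s := Finset.univ))
    have h1 : ∑ i, ‖inner ℂ (w i) g‖ ^ 2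
        = ∑ i ∈ Finset.univ.filter (fun i => σ i ≠ 0), ‖inner ℂ (w i) g‖ ^ 2 := by
      symm
      apply Finset.sum_filter_of_ne
      intro i _ hi h0
      apply hi
      simp [hw, h0]
    rw [h1]
    exact (Finset.sum_subtype (Finset.univ.filter (fun i => σ i ≠ 0)) (by simp) _)
  let U : EuclideanSpace ℂ ι →ₗ[ℂ] EuclideanSpace ℂ ι :=
    ∑ i, (LinearMap.toSpanSingleton ℂ _ (b i)).comp (innerₛₗ ℂ (w i))
  have hU : ∀ g, U g = ∑ i, inner ℂ (w i) g • b i := by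
    intro g
    simp [U, LinearMap.sum_apply]
  refine ⟨Matrix.toEuclideanLin.symm U, ?_, ?_⟩
  · intro f g
    rw [LinearEquiv.apply_symm_apply, hU, inner_sum]
    simp only [inner_smul_right]
    refine (norm_sum_le _ _).trans ?_
    simp only [norm_mul]
    refine (Real.sum_mul_le_sqrt_mul_sqrt _ _ _).trans ?_
    rw [one_mul, mul_comm]
    have h2 : √(∑ i, ‖inner ℂ f (b i)‖ ^ 2) = ‖f‖ := by
      rw [OrthonormalBasis.sum_sq_norm_inner_left, Real.sqrt_sq (norm_nonneg _)]
    rw [h2]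
    refine mul_le_mul_of_nonneg_left ?_ (norm_nonneg _)
    exact Real.sqrt_le_iff.mpr ⟨norm_nonneg _, hbessel g⟩
  · rw [trace_mul_eq_sum_inner _ X b, LinearEquiv.apply_symm_apply, traceNorm]
    push_cast
    refine Finset.sum_congr rfl fun i _ => ?_
    rw [hU, inner_sum]
    simp only [inner_smul_right, hww]
    have : ∀ j, inner ℂ (b i) (b j) = if i = j then (1 : ℂ) else 0 :=
      orthonormal_iff_ite.mp b.orthonormal i
    simp [this, hσ]

theorem traceNorm_nonneg (X : Matrix ι ι ℂ) : 0 ≤ traceNorm X :=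
  Finset.sum_nonneg fun _ _ => Real.sqrt_nonneg _

theorem inner_toEuclideanLin_eq (V : Matrix ι ι ℂ) (f g : EuclideanSpace ℂ ι) :
    inner ℂ f (Matrix.toEuclideanLin V g) = ∑ i, ∑ j, V i j * (g j * star (f i)) := by
  rw [PiLp.inner_apply]
  refine Finset.sum_congr rfl fun i _ => ?_
  simp [Matrix.mulVec, dotProduct, mul_assoc, Finset.mul_sum, mul_comm]

theorem FormBound.norm_apply_le {V : Matrix ι ι ℂ} {η : ℝ} (hV : FormBound V η) (i j : ι) :
    ‖V i j‖ ≤ η := by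
  have h := hV (EuclideanSpace.single i 1) (EuclideanSpace.single j 1)
  rw [inner_toEuclideanLin_eq] at h
  have e : (∑ i', ∑ j', V i' j' * ((EuclideanSpace.single j (1:ℂ)) j'
      * star ((EuclideanSpace.single i (1:ℂ)) i'))) = V i j := by
    rw [Finset.sum_eq_single i, Finset.sum_eq_single j]
    · simp
    · intro b _ hb; simp [hb]
    · simp
    · intro b _ hb; simp [hb]
    · simp
  rw [e] at h
  simpa using h

theorem traceNorm_le_sum_norm (X : Matrix ι ι ℂ) : traceNorm X ≤ ∑ i, ∑ j, ‖X i j‖ := by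
  obtain ⟨U, hU, h⟩ := exists_formBound_trace_mul_eq X
  have h1 : traceNorm X = ‖(U * X).trace‖ := by
    rw [h, Complex.norm_real, Real.norm_of_nonneg (traceNorm_nonneg X)]
  rw [h1, Matrix.trace, Finset.sum_comm]
  refine (norm_sum_le _ _).trans (Finset.sum_le_sum fun j _ => ?_)
  rw [Matrix.diag_apply, Matrix.mul_apply]
  refine (norm_sum_le _ _).trans (Finset.sum_le_sum fun i _ => ?_)
  rw [norm_mul]
  exact mul_le_of_le_one_left (norm_nonneg _) (hU.norm_apply_le _ _)

theorem norm_apply_le_traceNorm (X : Matrix ι ι ℂ) (i j : ι) : ‖X i j‖ ≤ traceNorm X := by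
  have hV : FormBound (Matrix.single j i (1 : ℂ)) 1 := by
    intro f g
    rw [inner_toEuclideanLin_eq]
    rw [Finset.sum_eq_single j, Finset.sum_eq_single i]
    · simp only [Matrix.single_apply_same, one_mul, norm_mul, norm_star]
      rw [mul_comm]
      exact mul_le_mul (PiLp.norm_apply_le f j) (PiLp.norm_apply_le g i) (norm_nonneg _)
        (norm_nonneg _)
    · intro b _ hb; simp [Ne.symm hb]
    · simp
    · intro b _ hb; simp [Ne.symm hb]
    · simp
  have := hV.norm_trace_mul_le X
  simpa [Matrix.trace_single_mul] using this

theorem traceNorm_single (i j : ι) : traceNorm (Matrix.single i j (1 : ℂ)) = 1 := by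
  apply le_antisymm
  · refine (traceNorm_le_sum_norm _).trans (le_of_eq ?_)
    rw [Finset.sum_eq_single i, Finset.sum_eq_single j]
    · simp
    · intro b _ hb; simp [Ne.symm hb]
    · simp
    · intro b _ hb; simp [Ne.symm hb]
    · simp
  · simpa using norm_apply_le_traceNorm (Matrix.single i j (1 : ℂ)) i j

end TraceNorm

section Diamond

variable {m n : Type*} [Fintype m] [DecidableEq m] [Fintype n] [DecidableEq n]

theorem bddAbove_traceNorm_ampliate (T : Matrix m m ℂ →ₗ[ℂ] Matrix n n ℂ) :
    BddAbove ((fun X : Matrix (m × m) (m × m) ℂ => traceNorm (ampliate T X)) ''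
      {X | traceNorm X = 1}) := by
  refine ⟨∑ i : n × m, ∑ j : n × m, ∑ k, ∑ l, ‖T (Matrix.single k l 1) i.1 j.1‖, ?_⟩
  rintro _ ⟨X, hX, rfl⟩
  refine (traceNorm_le_sum_norm _).trans (Finset.sum_le_sum fun i _ =>
    Finset.sum_le_sum fun j _ => ?_)
  have h : ampliate T X i j = ∑ k, ∑ l, X (k, i.2) (l, j.2) * T (Matrix.single k l 1) i.1 j.1 := by
    rw [ampliate]
    conv_lhs => rw [Matrix.matrix_eq_sum_single (fun k l => X (k, i.2) (l, j.2))]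
    simp only [map_sum, Matrix.sum_apply]
    refine Finset.sum_congr rfl fun k _ => Finset.sum_congr rfl fun l _ => ?_
    have : Matrix.single k l (X (k, i.2) (l, j.2))
        = X (k, i.2) (l, j.2) • Matrix.single k l (1 : ℂ) := by simp [Matrix.smul_single]
    rw [this, map_smul, Matrix.smul_apply, smul_eq_mul]
  rw [h]
  refine (norm_sum_le _ _).trans (Finset.sum_le_sum fun k _ => ?_)
  refine (norm_sum_le _ _).trans (Finset.sum_le_sum fun l _ => ?_)
  rw [norm_mul]
  refine mul_le_of_le_one_left (norm_nonneg _) ?_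
  rw [← (show traceNorm X = 1 from hX)]
  exact norm_apply_le_traceNorm _ _ _

/-- Every matrix entry of the image of a matrix unit is bounded by the diamond norm. -/
theorem norm_apply_single_le_diamondNorm (T : Matrix m m ℂ →ₗ[ℂ] Matrix n n ℂ) (x y : m)
    (i j : n) : ‖T (Matrix.single x y 1) i j‖ ≤ diamondNorm T := by
  have h := le_csSup (bddAbove_traceNorm_ampliate T)
    ⟨Matrix.single (x, x) (y, x) 1, traceNorm_single _ _, rfl⟩
  refine le_trans ?_ h
  refine le_trans (le_of_eq ?_) (norm_apply_le_traceNorm _ (i, x) (j, x))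
  congr 1
  simp only [ampliate]
  refine congrFun (congrFun (congrArg T ?_) i) j
  ext k l
  simp [Matrix.single_apply]

/-- A superoperator that reads out the diagonal of its input and prepares basis states with
weights `W` has diamond norm at most the largest absolute row sum of `W`. -/
theorem diamondNorm_le_of_classical {κ : Type*} [Fintype κ] (T : Matrix m m ℂ →ₗ[ℂ] Matrix n n ℂ)
    (W : m → κ → ℝ) (e : κ → n) {η : ℝ} (hη : 0 ≤ η) (hW : ∀ x, ∑ s, |W x s| ≤ η)
    (hT : ∀ ρ, T ρ = ∑ x, ∑ s, (ρ x x * W x s) • Matrix.single (e s) (e s) (1 : ℂ)) :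
    diamondNorm T ≤ η := by
  refine Real.sSup_le ?_ hη
  rintro _ ⟨X, hX, rfl⟩
  simp only
  obtain ⟨U, hU, hUX⟩ := exists_formBound_trace_mul_eq (ampliate T X)
  have h1 : traceNorm (ampliate T X) = ‖(U * ampliate T X).trace‖ := by
    rw [hUX, Complex.norm_real, Real.norm_of_nonneg (traceNorm_nonneg _)]
  -- The image of `U` under the adjoint of `T ⊗ id`; it is block diagonal, and its blocks are
  -- combinations with weights `W` of blocks of `U`.
  let V : Matrix (m × m) (m × m) ℂ := fun p q =>
    if p.1 = q.1 then ∑ s, (W p.1 s : ℂ) * U (e s, p.2) (e s, q.2) else 0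
  let Y : m → κ → Matrix (n × m) (n × m) ℂ := fun z s i j =>
    if e s = i.1 ∧ e s = j.1 then (W z s : ℂ) * X (z, i.2) (z, j.2) else 0
  have hYa : ∀ z s i j, Y z s i j =
      if e s = i.1 ∧ e s = j.1 then (W z s : ℂ) * X (z, i.2) (z, j.2) else 0 := fun _ _ _ _ => rfl
  have hVa : ∀ p q, V p q =
      if p.1 = q.1 then ∑ s, (W p.1 s : ℂ) * U (e s, p.2) (e s, q.2) else 0 := fun _ _ => rfl
  have hY : ampliate T X = ∑ z, ∑ s, Y z s := by
    ext i j
    have h0 : ampliate T X i j = T (Matrix.of fun k l => X (k, i.2) (l, j.2)) i.1 j.1 := rfl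
    rw [h0, hT]
    simp only [Matrix.of_apply, Matrix.sum_apply, Matrix.smul_apply, Matrix.single_apply, hYa]
    refine Finset.sum_congr rfl fun z _ => Finset.sum_congr rfl fun s _ => ?_
    split_ifs <;> simp [mul_comm]
  have hUY : ∀ z s, (U * Y z s).trace
      = ∑ y, ∑ y', (W z s : ℂ) * U (e s, y) (e s, y') * X (z, y') (z, y) := by
    intro z s
    simp only [Matrix.trace, Matrix.diag_apply, Matrix.mul_apply, Fintype.sum_prod_type, hYa]
    rw [Finset.sum_eq_single (e s)]
    · refine Finset.sum_congr rfl fun y _ => ?_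
      rw [Finset.sum_eq_single (e s)]
      · refine Finset.sum_congr rfl fun y' _ => ?_
        simp only [and_self, if_true]
        ring
      · intro x' _ hx'
        simp [Ne.symm hx']
      · simp
    · intro x _ hx
      simp [Ne.symm hx]
    · simp
  have h2 : (U * ampliate T X).trace = (V * X).trace := by
    simp only [hY, Matrix.mul_sum, Matrix.trace_sum, hUY]
    simp only [Matrix.trace, Matrix.diag_apply, Matrix.mul_apply, Fintype.sum_prod_type, hVa]
    refine Finset.sum_congr rfl fun z _ => ?_
    rw [Finset.sum_comm]
    refine Finset.sum_congr rfl fun y _ => ?_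
    rw [Finset.sum_eq_single z]
    · simp only [if_true, Finset.sum_mul]
      exact Finset.sum_comm
    · intro z' _ hz'
      simp [Ne.symm hz']
    · simp
  have h3 : FormBound V η := by
    intro f g
    -- Move the block `x` of a vector to the block `k`, and discard the rest.
    let sl : EuclideanSpace ℂ (m × m) → m → n → EuclideanSpace ℂ (n × m) := fun f x k =>
      WithLp.toLp 2 fun q => if q.1 = k then f (x, q.2) else 0
    let F : EuclideanSpace ℂ (m × m) → m → ℝ := fun f x => √(∑ y, ‖f (x, y)‖ ^ 2)
    have hsl : ∀ f x k, ‖sl f x k‖ = F f x := by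
      intro f x k
      rw [EuclideanSpace.norm_eq, Fintype.sum_prod_type, Finset.sum_eq_single k]
      · simp [sl, F]
      · intro b _ hb
        simp [sl, hb]
      · simp
    have hF : ∀ f, √(∑ x, F f x ^ 2) = ‖f‖ := by
      intro f
      rw [EuclideanSpace.norm_eq, Fintype.sum_prod_type]
      congr 1
      refine Finset.sum_congr rfl fun x _ => ?_
      exact Real.sq_sqrt (Finset.sum_nonneg fun _ _ => by positivity)
    have hin : inner ℂ f (Matrix.toEuclideanLin V g)
        = ∑ x, ∑ s, (W x s : ℂ) *
          inner ℂ (sl f x (e s)) (Matrix.toEuclideanLin U (sl g x (e s))) := by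
      simp only [inner_toEuclideanLin_eq, Fintype.sum_prod_type, hVa]
      refine Finset.sum_congr rfl fun x _ => ?_
      have : ∀ s, (∑ k, ∑ y, ∑ k', ∑ y', U (k, y) (k', y') *
          (sl g x (e s) (k', y') * star (sl f x (e s) (k, y))))
          = ∑ y, ∑ y', U (e s, y) (e s, y') * (g (x, y') * star (f (x, y))) := by
        intro s
        rw [Finset.sum_eq_single (e s)]
        · refine Finset.sum_congr rfl fun y _ => ?_
          rw [Finset.sum_eq_single (e s)]
          · simp [sl]
          · intro b _ hb
            simp [sl, hb]
          · simp
        · intro b _ hb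
          simp [sl, hb]
        · simp
      simp only [this, Finset.mul_sum]
      symm
      rw [Finset.sum_comm]
      refine Finset.sum_congr rfl fun y _ => ?_
      symm
      rw [Finset.sum_eq_single x]
      · simp only [if_true, Finset.sum_mul]
        rw [Finset.sum_comm]
        refine Finset.sum_congr rfl fun s _ => Finset.sum_congr rfl fun y' _ => ?_
        ring
      · intro b _ hb
        simp [Ne.symm hb]
      · simp
    rw [hin]
    have hterm : ∀ x, ‖∑ s, (W x s : ℂ) *
        inner ℂ (sl f x (e s)) (Matrix.toEuclideanLin U (sl g x (e s)))‖
        ≤ η * (F f x * F g x) := by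
      intro x
      refine (norm_sum_le _ _).trans ?_
      have : ∀ s, ‖(W x s : ℂ) *
          inner ℂ (sl f x (e s)) (Matrix.toEuclideanLin U (sl g x (e s)))‖
          ≤ |W x s| * (F f x * F g x) := by
        intro s
        rw [norm_mul, Complex.norm_real, Real.norm_eq_abs]
        refine mul_le_mul_of_nonneg_left ?_ (abs_nonneg _)
        have := hU (sl f x (e s)) (sl g x (e s))
        rwa [hsl, hsl, one_mul] at this
      refine (Finset.sum_le_sum fun s _ => this s).trans ?_
      rw [← Finset.sum_mul]
      exact mul_le_mul_of_nonneg_right (hW x) (by positivity)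
    refine (norm_sum_le _ _).trans ((Finset.sum_le_sum fun x _ => hterm x).trans ?_)
    rw [← Finset.mul_sum, mul_assoc, ← hF f, ← hF g]
    exact mul_le_mul_of_nonneg_left (Real.sum_mul_le_sqrt_mul_sqrt _ _ _) hη
  rw [h1, h2]
  refine (h3.norm_trace_mul_le X).trans (le_of_eq ?_)
  rw [show traceNorm X = 1 from hX, mul_one]

end Diamond

/-! ### The evolution generated by a diagonal Lindbladian -/

section Evolution

/-- The exponential respects intertwining relations, also between matrices of different sizes. -/
theorem exp_mul_of_mul_eq_mul {m n : Type*} [Fintype m] [DecidableEq m] [Fintype n] [DecidableEq n]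
    {A : Matrix m m ℂ} {B : Matrix n n ℂ} {J : Matrix m n ℂ} (h : A * J = J * B) :
    NormedSpace.exp A * J = J * NormedSpace.exp B := by
  let _ : NormedRing (Matrix m m ℂ) := Matrix.linftyOpNormedRing
  let _ : NormedAlgebra ℂ (Matrix m m ℂ) := Matrix.linftyOpNormedAlgebra
  let _ : NormedRing (Matrix n n ℂ) := Matrix.linftyOpNormedRing
  let _ : NormedAlgebra ℂ (Matrix n n ℂ) := Matrix.linftyOpNormedAlgebra
  have hpow : ∀ k : ℕ, A ^ k * J = J * B ^ k := by
    intro k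
    induction k with
    | zero => simp
    | succ k ih => rw [pow_succ, Matrix.mul_assoc, h, ← Matrix.mul_assoc, ih, Matrix.mul_assoc,
        ← pow_succ]
  have hA := NormedSpace.exp_series_hasSum_exp' (𝕂 := ℂ) A
  have hB := NormedSpace.exp_series_hasSum_exp' (𝕂 := ℂ) B
  have hA' := hA.map (AddMonoidHom.mk' (fun M : Matrix m m ℂ => M * J)
    (fun M M' => Matrix.add_mul M M' J)) (continuous_id.matrix_mul continuous_const)
  have hB' := hB.map (AddMonoidHom.mk' (fun M : Matrix n n ℂ => J * M)
    (fun M M' => Matrix.mul_add J M M')) (continuous_const.matrix_mul continuous_id)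
  refine hA'.unique ?_
  have e : (AddMonoidHom.mk' (fun M : Matrix m m ℂ => M * J)
      (fun M M' => Matrix.add_mul M M' J)) ∘ (fun k : ℕ => ((k.factorial : ℂ))⁻¹ • A ^ k)
      = (AddMonoidHom.mk' (fun M : Matrix n n ℂ => J * M)
      (fun M M' => Matrix.mul_add J M M')) ∘ (fun k : ℕ => ((k.factorial : ℂ))⁻¹ • B ^ k) := by
    funext k
    simp [hpow]
  rw [e]
  exact hB'

/-- On the span of vectors `e c` that is invariant under a superoperator, the evolution is the
exponential of the matrix of the restriction. -/
theorem evolution_of_invariant {N : ℕ} {κ : Type*} [Fintype κ] [DecidableEq κ]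
    (T : Matrix (Fin N) (Fin N) ℂ →ₗ[ℂ] Matrix (Fin N) (Fin N) ℂ) (t : ℝ)
    (e : κ → Matrix (Fin N) (Fin N) ℂ) (B : Matrix κ κ ℂ)
    (h : ∀ c, T (e c) = ∑ c', B c' c • e c') (c : κ) :
    evolution T t (e c) = ∑ c', NormedSpace.exp ((t : ℂ) • B) c' c • e c' := by
  set b := Matrix.stdBasis ℂ (Fin N) (Fin N)
  let J : Matrix (Fin N × Fin N) κ ℂ := Matrix.of fun p c => b.repr (e c) p
  have hmul : ∀ (A : Matrix (Fin N × Fin N) (Fin N × Fin N) ℂ) (c : κ) p,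
      (A * J) p c = (A *ᵥ b.repr (e c)) p := fun A c p => rfl
  have hsum : ∀ (D : Matrix κ κ ℂ) c p, (J * D) p c = b.repr (∑ c', D c' c • e c') p := by
    intro D c p
    simp [J, Matrix.mul_apply, Finsupp.finsetSum_apply, mul_comm]
  have hAJ : LinearMap.toMatrix b b ((t : ℂ) • T) * J = J * ((t : ℂ) • B) := by
    ext p c
    rw [hmul, LinearMap.toMatrix_mulVec_repr, hsum, LinearMap.smul_apply, h, Finset.smul_sum]
    simp only [Matrix.smul_apply, smul_assoc]
  have hexp := exp_mul_of_mul_eq_mul hAJ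
  apply b.repr.injective
  ext p
  rw [← hsum, ← hexp, hmul, evolution, Matrix.repr_toLin]

theorem single_same_mul_single {N : ℕ} (l x y : Fin N) :
    Matrix.single l l (1 : ℂ) * Matrix.single x y (1 : ℂ)
      = if l = x then Matrix.single x y 1 else 0 := by
  split_ifs with h
  · subst h
    rw [Matrix.single_mul_single_same, one_mul]
  · exact Matrix.single_mul_single_of_ne (h := h) ..

theorem single_mul_single_self {N : ℕ} (l x y : Fin N) :
    Matrix.single x y (1 : ℂ) * Matrix.single l l (1 : ℂ)
      = if l = y then Matrix.single x y 1 else 0 := by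
  split_ifs with h
  · subst h
    rw [Matrix.single_mul_single_same, one_mul]
  · exact Matrix.single_mul_single_of_ne (h := Ne.symm h) ..

theorem lindbladian_single_of_ne {N : ℕ} (a : Matrix (Fin N) (Fin N) ℝ) {x y : Fin N}
    (h : x ≠ y) : lindbladian a (Matrix.single x y 1)
      = ((-((∑ k, a k x) + ∑ k, a k y) : ℝ) : ℂ) • Matrix.single x y 1 := by
  have h1 : ∀ k l, (a k l : ℂ) • ((2 * (Matrix.single x y (1 : ℂ)) l l) •
      Matrix.single k k (1 : ℂ) - Matrix.single l l (1 : ℂ) * Matrix.single x y (1 : ℂ)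
      - Matrix.single x y (1 : ℂ) * Matrix.single l l (1 : ℂ))
      = (if l = x then -(a k x : ℂ) • Matrix.single x y (1 : ℂ) else 0)
        + (if l = y then -(a k y : ℂ) • Matrix.single x y (1 : ℂ) else 0) := by
    intro k l
    have h0 : (Matrix.single x y (1 : ℂ)) l l = 0 := by
      rw [Matrix.single_apply, if_neg]
      rintro ⟨rfl, rfl⟩
      exact h rfl
    rw [h0, single_same_mul_single, single_mul_single_self]
    split_ifs with hx hy hy
    · exact absurd (hx.symm.trans hy) h
    · subst hx
      simp
    · subst hy
      simp
    · simp
  change ∑ k, ∑ l, (a k l : ℂ) • ((2 * (Matrix.single x y (1 : ℂ)) l l) •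
      Matrix.single k k (1 : ℂ) - Matrix.single l l (1 : ℂ) * Matrix.single x y (1 : ℂ)
      - Matrix.single x y (1 : ℂ) * Matrix.single l l (1 : ℂ)) = _
  simp only [h1, Finset.sum_add_distrib, Finset.sum_ite_eq', Finset.mem_univ, if_true]
  rw [← Finset.sum_smul, ← Finset.sum_smul, ← add_smul]
  congr 1
  push_cast
  rw [Finset.sum_neg_distrib, Finset.sum_neg_distrib]
  ring

/-- The generator of the classical Markov chain that a diagonal Lindbladian induces on diagonal
matrices, acting on row vectors: the rate of jumps from `x` to `s` is `2 a s x`. -/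
def generator {N : ℕ} (a : Matrix (Fin N) (Fin N) ℝ) : Matrix (Fin N) (Fin N) ℝ :=
  Matrix.of fun x s => 2 * (a s x - if x = s then ∑ k, a k x else 0)

theorem lindbladian_single_same {N : ℕ} (a : Matrix (Fin N) (Fin N) ℝ) (x : Fin N) :
    lindbladian a (Matrix.single x x 1)
      = ∑ s, ((generator a x s : ℝ) : ℂ) • Matrix.single s s 1 := by
  have h1 : ∀ k l, (a k l : ℂ) • ((2 * (Matrix.single x x (1 : ℂ)) l l) •
      Matrix.single k k (1 : ℂ) - Matrix.single l l (1 : ℂ) * Matrix.single x x (1 : ℂ)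
      - Matrix.single x x (1 : ℂ) * Matrix.single l l (1 : ℂ))
      = if l = x then (2 * a k x : ℂ) • Matrix.single k k (1 : ℂ)
          - (2 * a k x : ℂ) • Matrix.single x x (1 : ℂ) else 0 := by
    intro k l
    by_cases hx : l = x
    · subst hx
      rw [if_pos rfl, single_same_mul_single, if_pos rfl]
      simp only [Matrix.single_apply_same, mul_one, smul_sub, smul_smul]
      rw [sub_sub, ← add_smul]
      congr 2 <;> ring
    · rw [if_neg hx, single_same_mul_single, single_mul_single_self, if_neg hx,
        Matrix.single_apply, if_neg]
      · simp
      · rintro ⟨rfl, -⟩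
        exact hx rfl
  change ∑ k, ∑ l, (a k l : ℂ) • ((2 * (Matrix.single x x (1 : ℂ)) l l) •
      Matrix.single k k (1 : ℂ) - Matrix.single l l (1 : ℂ) * Matrix.single x x (1 : ℂ)
      - Matrix.single x x (1 : ℂ) * Matrix.single l l (1 : ℂ)) = _
  simp only [h1, Finset.sum_ite_eq', Finset.mem_univ, if_true]
  have h2 : ∀ s, ((generator a x s : ℝ) : ℂ) • Matrix.single s s (1 : ℂ)
      = (2 * a s x : ℂ) • Matrix.single s s (1 : ℂ)
        - (if x = s then (2 * ∑ k, a k x : ℂ) • Matrix.single s s (1 : ℂ) else 0) := by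
    intro s
    rw [generator, Matrix.of_apply]
    split_ifs
    · rw [← sub_smul]
      congr 1
      push_cast
      ring
    · simp
  simp only [h2, Finset.sum_sub_distrib, Finset.sum_ite_eq, Finset.mem_univ, if_true]
  rw [Complex.ofReal_sum, Finset.mul_sum, Finset.sum_smul]

theorem evolution_lindbladian_single_of_ne {N : ℕ} (a : Matrix (Fin N) (Fin N) ℝ) (t : ℝ)
    {x y : Fin N} (h : x ≠ y) : evolution (lindbladian a) t (Matrix.single x y 1)
      = ((Real.exp (-((∑ k, a k x) + ∑ k, a k y) * t) : ℝ) : ℂ) • Matrix.single x y 1 := by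
  have := evolution_of_invariant (lindbladian a) t (fun _ : Unit => Matrix.single x y (1 : ℂ))
    (Matrix.diagonal fun _ => ((-((∑ k, a k x) + ∑ k, a k y) : ℝ) : ℂ))
    (fun c => by simpa using lindbladian_single_of_ne a h) ()
  rw [this, ← Matrix.diagonal_smul, Matrix.exp_diagonal]
  simp only [Finset.univ_unique, Finset.sum_singleton, Matrix.diagonal_apply_eq]
  rw [Pi.coe_exp]
  congr 1
  rw [Complex.ofReal_exp, Complex.exp_eq_exp_ℂ]
  simp [mul_comm]

theorem evolution_lindbladian_single_same {N : ℕ} (a : Matrix (Fin N) (Fin N) ℝ) (t : ℝ)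
    (x : Fin N) : evolution (lindbladian a) t (Matrix.single x x 1)
      = ∑ s, ((NormedSpace.exp (t • generator a) x s : ℝ) : ℂ) • Matrix.single s s 1 := by
  have := evolution_of_invariant (lindbladian a) t (fun s => Matrix.single s s (1 : ℂ))
    ((generator a).map (Complex.ofRealHom))ᵀ (fun c => by simpa using lindbladian_single_same a c) x
  rw [this]
  have h2 : NormedSpace.exp ((t : ℂ) • ((generator a).map (Complex.ofRealHom))ᵀ)
      = ((NormedSpace.exp (t • generator a)).map Complex.ofRealHom)ᵀ := by
    rw [← Matrix.transpose_smul, Matrix.exp_transpose]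
    congr 1
    let _ : NormedRing (Matrix (Fin N) (Fin N) ℝ) := Matrix.linftyOpNormedRing
    let _ : NormedAlgebra ℝ (Matrix (Fin N) (Fin N) ℝ) := Matrix.linftyOpNormedAlgebra
    let _ : NormedAlgebra ℚ (Matrix (Fin N) (Fin N) ℝ) := Matrix.linftyOpNormedAlgebra
    have : CompleteSpace (Matrix (Fin N) (Fin N) ℝ) := FiniteDimensional.complete ℝ _
    let _ : NormedRing (Matrix (Fin N) (Fin N) ℂ) := Matrix.linftyOpNormedRing
    have := NormedSpace.map_exp (Complex.ofRealHom.mapMatrix (m := Fin N))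
      (continuous_id.matrix_map Complex.continuous_ofReal) (t • generator a)
    refine Eq.trans ?_ this.symm
    congr 1
    ext i j
    simp
  rw [h2]
  simp

end Evolution

/-! ### Second order expansions in a Banach algebra -/

section SecondOrder

variable {𝔸 : Type*} [NormedRing 𝔸]

/-- The exponential series without its terms of degree at most two. -/
noncomputable def expTail (c : ℝ) : ℝ := Real.exp c - 1 - c - c ^ 2 / 2

/-- The element `g` has the second order expansion `1 + u + v`, all terms and the remainder being
majorized by those of the scalar exponential series `exp c`. -/
structure SecondOrder (g u v : 𝔸) (c : ℝ) : Prop where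
  first : ‖u‖ ≤ c
  second : ‖v‖ ≤ c ^ 2 / 2
  remainder : ‖g - 1 - u - v‖ ≤ expTail c

theorem cube_le_expTail {c : ℝ} (hc : 0 ≤ c) : c ^ 3 / 6 ≤ expTail c := by
  have h := Real.sum_le_exp_of_nonneg hc 4
  simp [Finset.sum_range_succ, Nat.factorial] at h
  unfold expTail
  linarith

theorem expTail_nonneg {c : ℝ} (hc : 0 ≤ c) : 0 ≤ expTail c :=
  le_trans (by positivity) (cube_le_expTail hc)

theorem expTail_le {c : ℝ} (hc : 0 ≤ c) (hc1 : c ≤ 1) : expTail c ≤ 2 / 9 * c ^ 3 := by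
  have h := Real.exp_bound' hc hc1 (n := 3) (by norm_num)
  simp [Finset.sum_range_succ, Nat.factorial] at h
  unfold expTail
  linarith

theorem SecondOrder.nonneg {g u v : 𝔸} {c : ℝ} (h : SecondOrder g u v c) : 0 ≤ c :=
  (norm_nonneg u).trans h.first

theorem SecondOrder.norm_le [NormOneClass 𝔸] {g u v : 𝔸} {c : ℝ} (h : SecondOrder g u v c) :
    ‖g‖ ≤ Real.exp c := by
  have e : g = 1 + u + v + (g - 1 - u - v) := by abel
  have h1 := h.first
  have h2 := h.second
  have h3 := h.remainder
  rw [expTail] at h3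
  calc ‖g‖ ≤ ‖(1 : 𝔸)‖ + ‖u‖ + ‖v‖ + ‖g - 1 - u - v‖ := by
        conv_lhs => rw [e]
        exact norm_add₄_le
    _ ≤ Real.exp c := by rw [norm_one]; linarith

theorem SecondOrder.one : SecondOrder (1 : 𝔸) 0 0 0 where
  first := by simp
  second := by simp
  remainder := by simp [expTail]

theorem SecondOrder.mul [NormOneClass 𝔸] {g u v g' u' v' : 𝔸} {c c' : ℝ}
    (h : SecondOrder g u v c) (h' : SecondOrder g' u' v' c') :
    SecondOrder (g * g') (u + u') (v + v' + u * u') (c + c') where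
  first := (norm_add_le _ _).trans (add_le_add h.first h'.first)
  second := by
    have h1 : ‖u * u'‖ ≤ c * c' :=
      (norm_mul_le _ _).trans (mul_le_mul h.first h'.first (norm_nonneg _) h.nonneg)
    calc ‖v + v' + u * u'‖ ≤ ‖v‖ + ‖v'‖ + ‖u * u'‖ := norm_add₃_le
      _ ≤ c ^ 2 / 2 + c' ^ 2 / 2 + c * c' := add_le_add (add_le_add h.second h'.second) h1
      _ = _ := by ring
  remainder := by
    have hc := h.nonneg
    have hc' := h'.nonneg
    have e : g * g' - 1 - (u + u') - (v + v' + u * u')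
        = (g - 1 - u - v) * g' + (1 + u + v) * (g' - 1 - u' - v')
          + (u * v' + v * u' + v * v') := by noncomm_ring
    have hT : ‖1 + u + v‖ ≤ 1 + c + c ^ 2 / 2 := by
      refine norm_add₃_le.trans ?_
      rw [norm_one]
      exact add_le_add (add_le_add le_rfl h.first) h.second
    have b1 : ‖(g - 1 - u - v) * g'‖ ≤ expTail c * Real.exp c' :=
      (norm_mul_le _ _).trans (mul_le_mul h.remainder h'.norm_le (norm_nonneg _)
        (expTail_nonneg hc))
    have b2 : ‖(1 + u + v) * (g' - 1 - u' - v')‖ ≤ (1 + c + c ^ 2 / 2) * expTail c' :=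
      (norm_mul_le _ _).trans (mul_le_mul hT h'.remainder (norm_nonneg _) (by positivity))
    have b3 : ‖u * v' + v * u' + v * v'‖ ≤ c * (c' ^ 2 / 2) + c ^ 2 / 2 * c'
        + c ^ 2 / 2 * (c' ^ 2 / 2) := by
      refine norm_add₃_le.trans (add_le_add (add_le_add ?_ ?_) ?_)
      · exact (norm_mul_le _ _).trans (mul_le_mul h.first h'.second (norm_nonneg _) hc)
      · exact (norm_mul_le _ _).trans (mul_le_mul h.second h'.first (norm_nonneg _) (by positivity))
      · exact (norm_mul_le _ _).trans
          (mul_le_mul h.second h'.second (norm_nonneg _) (by positivity))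
    rw [e]
    refine (norm_add₃_le.trans (add_le_add (add_le_add b1 b2) b3)).trans (le_of_eq ?_)
    simp only [expTail, Real.exp_add]
    ring

theorem norm_pow_sub_pow_le [NormOneClass 𝔸] {p q : 𝔸} (hp : ‖p‖ ≤ 1) (hq : ‖q‖ ≤ 1) (r : ℕ) :
    ‖p ^ r - q ^ r‖ ≤ r * ‖p - q‖ := by
  induction r with
  | zero => simp
  | succ r ih =>
    have e : p ^ (r + 1) - q ^ (r + 1) = p ^ r * (p - q) + (p ^ r - q ^ r) * q := by
      rw [pow_succ, pow_succ]
      noncomm_ring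
    have h1 : ‖p ^ r * (p - q)‖ ≤ 1 * ‖p - q‖ :=
      (norm_mul_le _ _).trans (mul_le_mul_of_nonneg_right
        ((norm_pow_le _ _).trans (pow_le_one₀ (norm_nonneg _) hp)) (norm_nonneg _))
    have h2 : ‖(p ^ r - q ^ r) * q‖ ≤ r * ‖p - q‖ * 1 :=
      (norm_mul_le _ _).trans (mul_le_mul ih hq (norm_nonneg _) (by positivity))
    rw [e]
    refine (norm_add_le_of_le h1 h2).trans (le_of_eq ?_)
    push_cast
    ring

variable [NormedAlgebra ℝ 𝔸]

theorem SecondOrder.exp [NormOneClass 𝔸] [CompleteSpace 𝔸] {x : 𝔸} {c : ℝ} (h : ‖x‖ ≤ c) :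
    SecondOrder (NormedSpace.exp x) x ((2⁻¹ : ℝ) • (x * x)) c where
  first := h
  second := by
    rw [norm_smul, Real.norm_of_nonneg (by norm_num)]
    have : ‖x * x‖ ≤ c * c :=
      (norm_mul_le _ _).trans (mul_le_mul h h (norm_nonneg _) ((norm_nonneg _).trans h))
    linarith
  remainder := by
    have h1 := (hasSum_nat_add_iff' 3).mpr (NormedSpace.exp_series_hasSum_exp' (𝕂 := ℝ) x)
    have h2 := (hasSum_nat_add_iff' 3).mpr (NormedSpace.exp_series_hasSum_exp' (𝕂 := ℝ) c)
    have e1 : NormedSpace.exp x - 1 - x - (2⁻¹ : ℝ) • (x * x)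
        = NormedSpace.exp x - ∑ i ∈ Finset.range 3, ((i.factorial : ℝ))⁻¹ • x ^ i := by
      simp [Finset.sum_range_succ, Nat.factorial, pow_two]
      abel
    have e2 : expTail c
        = NormedSpace.exp c - ∑ i ∈ Finset.range 3, ((i.factorial : ℝ))⁻¹ • c ^ i := by
      rw [← Real.exp_eq_exp_ℝ]
      simp [Finset.sum_range_succ, Nat.factorial, expTail]
      ring
    rw [e1, e2]
    refine h1.norm_le_of_bounded h2 fun i => ?_
    rw [norm_smul, Real.norm_of_nonneg (by positivity), smul_eq_mul]
    refine mul_le_mul_of_nonneg_left ?_ (by positivity)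
    exact (norm_pow_le x _).trans (by gcongr)

theorem norm_exp_le_exp [NormOneClass 𝔸] [CompleteSpace 𝔸] (x : 𝔸) :
    ‖NormedSpace.exp x‖ ≤ Real.exp ‖x‖ :=
  (SecondOrder.exp le_rfl).norm_le

/-- Two products in opposite order have second order terms that complement each other. -/
theorem SecondOrder.list_prod [NormOneClass 𝔸] {κ : Type*} (g u : κ → 𝔸) {c : ℝ}
    (hg : ∀ i, SecondOrder (g i) (u i) ((2⁻¹ : ℝ) • (u i * u i)) c) (l : List κ) :
    ∃ V V' : 𝔸, V + V' = (l.map u).sum * (l.map u).sum ∧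
      SecondOrder (l.map g).prod (l.map u).sum V (l.length * c) ∧
      SecondOrder (l.reverse.map g).prod (l.map u).sum V' (l.length * c) := by
  induction l with
  | nil => exact ⟨0, 0, by simp, by simpa using SecondOrder.one, by simpa using SecondOrder.one⟩
  | cons i l ih =>
    obtain ⟨V, V', hV, h, h'⟩ := ih
    refine ⟨(2⁻¹ : ℝ) • (u i * u i) + V + u i * (l.map u).sum,
      V' + (2⁻¹ : ℝ) • (u i * u i) + (l.map u).sum * u i, ?_, ?_, ?_⟩
    · have e : (2⁻¹ : ℝ) • (u i * u i) + (2⁻¹ : ℝ) • (u i * u i) = u i * u i := by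
        rw [← add_smul]
        norm_num
      have : (2⁻¹ : ℝ) • (u i * u i) + V + u i * (l.map u).sum
          + (V' + (2⁻¹ : ℝ) • (u i * u i) + (l.map u).sum * u i)
          = ((2⁻¹ : ℝ) • (u i * u i) + (2⁻¹ : ℝ) • (u i * u i)) + (V + V')
            + u i * (l.map u).sum + (l.map u).sum * u i := by abel
      rw [this, e, hV, List.map_cons, List.sum_cons]
      noncomm_ring
    · have := (hg i).mul h
      rw [List.map_cons, List.prod_cons, List.map_cons, List.sum_cons, List.length_cons]
      convert this using 1
      push_cast
      ring
    · have := h'.mul (hg i)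
      rw [List.reverse_cons, List.map_append, List.prod_append, List.map_cons, List.map_cons,
        List.sum_cons, List.length_cons, add_comm (u i)]
      simp only [List.map_nil, List.prod_singleton]
      convert this using 1
      push_cast
      ring

/-- A palindromic product agrees with the exponential to second order. -/
theorem norm_palindrome_sub_exp_le [NormOneClass 𝔸] [CompleteSpace 𝔸] {κ : Type*} (g u : κ → 𝔸)
    {c : ℝ} (hg : ∀ i, SecondOrder (g i) (u i) ((2⁻¹ : ℝ) • (u i * u i)) c) (l : List κ) :
    ‖((l ++ l.reverse).map g).prod - NormedSpace.exp ((2 : ℝ) • (l.map u).sum)‖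
      ≤ 2 * expTail (2 * l.length * c) := by
  obtain ⟨V, V', hV, h, h'⟩ := SecondOrder.list_prod g u hg l
  set S := (l.map u).sum
  have hc : l.length * c + l.length * c = 2 * l.length * c := by ring
  have hp := h.mul h'
  have he := SecondOrder.exp (x := S + S) (norm_add_le_of_le h.first h.first)
  have hv : (2⁻¹ : ℝ) • ((S + S) * (S + S)) = V + V' + S * S := by
    rw [hV, show (S + S) * (S + S) = (2 : ℝ) • (S * S + S * S) by rw [two_smul]; noncomm_ring,
      smul_smul]
    norm_num
  rw [hv] at he
  rw [hc] at hp he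
  rw [List.map_append, List.prod_append, two_smul]
  have e : (l.map g).prod * (l.reverse.map g).prod - NormedSpace.exp (S + S)
      = ((l.map g).prod * (l.reverse.map g).prod - 1 - (S + S) - (V + V' + S * S))
        - (NormedSpace.exp (S + S) - 1 - (S + S) - (V + V' + S * S)) := by abel
  rw [e, two_mul]
  exact norm_sub_le_of_le hp.remainder he.remainder

/-- The algebra behind the second order accuracy of a jump attempt: `E` and `E'` are expanded in
`Y`, and the terms up to second order in `Y` are those of the exponential. -/
theorem SecondOrder.of_expansion [NormOneClass 𝔸] {Y M E E' : 𝔸} {h : ℝ} (hY : ‖Y‖ ≤ h)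
    (hM : ‖M‖ ≤ 1) (hE : ‖E - Y + (2⁻¹ : ℝ) • (Y * Y)‖ ≤ expTail h)
    (hE' : ‖E' - (2⁻¹ : ℝ) • Y‖ ≤ h ^ 2 / 8) (hE1 : ‖E'‖ ≤ h / 2)
    (hF : ‖1 - E' + E' * M‖ ≤ 1) :
    SecondOrder (1 - E + E * (M * (1 - E' + E' * M))) (Y * (M - 1))
      ((2⁻¹ : ℝ) • ((Y * (M - 1)) * (Y * (M - 1)))) (2 * h) := by
  have h0 : 0 ≤ h := (norm_nonneg _).trans hY
  have hM1 : ‖M - 1‖ ≤ 2 := by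
    refine (norm_sub_le _ _).trans ?_
    rw [norm_one]
    linarith
  have hu : ‖Y * (M - 1)‖ ≤ 2 * h := by
    refine (norm_mul_le _ _).trans ?_
    rw [mul_comm 2 h]
    exact mul_le_mul hY hM1 (norm_nonneg _) h0
  refine ⟨hu, ?_, ?_⟩
  · rw [norm_smul, Real.norm_of_nonneg (by norm_num)]
    have := (norm_mul_le _ _).trans (mul_le_mul hu hu (norm_nonneg _) (by positivity))
    linarith
  · set R := E - Y + (2⁻¹ : ℝ) • (Y * Y) with hR
    set R' := E' - (2⁻¹ : ℝ) • Y with hR'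
    set G := M * (1 - E' + E' * M) - 1 with hG
    have eE : E = Y - (2⁻¹ : ℝ) • (Y * Y) + R := by rw [hR]; abel
    have eG : G = (M - 1) + M * E' * (M - 1) := by rw [hG]; noncomm_ring
    have key : 1 - E + E * (M * (1 - E' + E' * M)) - 1 - Y * (M - 1)
        - (2⁻¹ : ℝ) • ((Y * (M - 1)) * (Y * (M - 1)))
        = R * G + Y * (M * (R' * (M - 1))) - (2⁻¹ : ℝ) • (Y * (Y * (M * (E' * (M - 1))))) := by
      have e1 : 1 - E + E * (M * (1 - E' + E' * M)) - 1 = E * G := by rw [hG]; noncomm_ring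
      have e2 : E * G = R * G + Y * G - (2⁻¹ : ℝ) • (Y * (Y * G)) := by
        conv_lhs => rw [eE]
        simp only [add_mul, sub_mul, smul_mul_assoc, mul_assoc]
        abel
      have e3 : Y * (M * (R' * (M - 1))) = Y * (M * (E' * (M - 1)))
          - (2⁻¹ : ℝ) • (Y * (M * (Y * (M - 1)))) := by
        rw [hR']
        simp only [sub_mul, mul_sub, smul_mul_assoc, mul_smul_comm, smul_sub]
        abel
      rw [e1, e2, e3, eG]
      simp only [mul_add, mul_sub, sub_mul, smul_add, smul_sub, mul_assoc, mul_one]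
      abel
    have hGn : ‖G‖ ≤ 2 := by
      rw [hG]
      refine (norm_sub_le _ _).trans ?_
      have := (norm_mul_le M (1 - E' + E' * M)).trans
        (mul_le_mul hM hF (norm_nonneg _) zero_le_one)
      rw [norm_one]
      linarith
    have b1 : ‖R * G‖ ≤ expTail h * 2 :=
      (norm_mul_le _ _).trans (mul_le_mul hE hGn (norm_nonneg _) (expTail_nonneg h0))
    have b2 : ‖Y * (M * (R' * (M - 1)))‖ ≤ h * (1 * (h ^ 2 / 8 * 2)) :=
      (norm_mul_le _ _).trans (mul_le_mul hY ((norm_mul_le _ _).trans (mul_le_mul hM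
        ((norm_mul_le _ _).trans (mul_le_mul hE' hM1 (norm_nonneg _) (by positivity)))
        (norm_nonneg _) zero_le_one)) (norm_nonneg _) h0)
    have b3 : ‖Y * (Y * (M * (E' * (M - 1))))‖ ≤ h * (h * (1 * (h / 2 * 2))) :=
      (norm_mul_le _ _).trans (mul_le_mul hY ((norm_mul_le _ _).trans (mul_le_mul hY
        ((norm_mul_le _ _).trans (mul_le_mul hM
        ((norm_mul_le _ _).trans (mul_le_mul hE1 hM1 (norm_nonneg _) (by positivity)))
        (norm_nonneg _) zero_le_one)) (norm_nonneg _) h0)) (norm_nonneg _) h0)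
    have b3' : ‖(2⁻¹ : ℝ) • (Y * (Y * (M * (E' * (M - 1)))))‖ ≤ h ^ 3 / 2 := by
      rw [norm_smul, Real.norm_of_nonneg (by norm_num)]
      linarith
    rw [key]
    refine (norm_sub_le_of_le (norm_add_le_of_le b1 b2) b3').trans ?_
    have h2 : expTail (2 * h) = h ^ 3 + h ^ 4 / 4 + 2 * expTail h * (1 + h + h ^ 2 / 2)
        + expTail h ^ 2 := by
      simp only [expTail, two_mul, Real.exp_add]
      ring
    have h3 := expTail_nonneg h0
    have h4 : 0 ≤ h ^ 3 := by positivity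
    have h5 : 0 ≤ h ^ 4 := by positivity
    have h6 : 0 ≤ expTail h * h := by positivity
    have h7 : 0 ≤ expTail h * h ^ 2 := by positivity
    have h8 : 0 ≤ expTail h ^ 2 := by positivity
    rw [h2]
    nlinarith

end SecondOrder

/-! ### The classical Markov chain and jump attempts -/

section JumpAttempt

-- The norm of a real matrix is its largest absolute row sum.
open scoped Matrix.Norms.Operator

variable {N : ℕ}

theorem sum_abs_row_le_norm {m n : Type*} [Fintype m] [Fintype n] (A : Matrix m n ℝ) (x : m) :
    ∑ s, |A x s| ≤ ‖A‖ := by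
  rw [Matrix.linfty_opNorm_def]
  have := Finset.le_sup (f := fun i => ∑ j, ‖A i j‖₊) (Finset.mem_univ x)
  have h2 : ((∑ j, ‖A x j‖₊ : NNReal) : ℝ) ≤ _ := NNReal.coe_le_coe.mpr this
  simpa using h2

theorem norm_le_of_sum_abs_row_le {m n : Type*} [Fintype m] [Fintype n] {A : Matrix m n ℝ} {c : ℝ}
    (hc : 0 ≤ c) (h : ∀ x, ∑ s, |A x s| ≤ c) : ‖A‖ ≤ c := by
  rw [Matrix.linfty_opNorm_def]
  lift c to NNReal using hc
  rw [NNReal.coe_le_coe]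
  refine Finset.sup_le fun x _ => ?_
  rw [← NNReal.coe_le_coe]
  simpa using h x

/-- The transition matrix (acting on row vectors) of the deterministic move along `k`. -/
def jumpMatrix (k : Fin N → Fin N) : Matrix (Fin N) (Fin N) ℝ :=
  Matrix.of fun x s => if s = k x then 1 else 0

theorem jumpMatrix_mul_apply (k : Fin N → Fin N) (M : Matrix (Fin N) (Fin N) ℝ) (u v : Fin N) :
    (jumpMatrix k * M) u v = M (k u) v := by
  rw [Matrix.mul_apply, Finset.sum_eq_single (k u)]
  · simp [jumpMatrix]
  · intro b _ hb
    simp [jumpMatrix, hb]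
  · simp

theorem norm_diagonal_add_diagonal_mul_le (p q : Fin N → ℝ) (k : Fin N → Fin N) {c : ℝ}
    (hc : 0 ≤ c) (hp : ∀ x, 0 ≤ p x) (hq : ∀ x, 0 ≤ q x) (h : ∀ x, q x + p x ≤ c) :
    ‖Matrix.diagonal q + Matrix.diagonal p * jumpMatrix k‖ ≤ c := by
  refine norm_le_of_sum_abs_row_le hc fun x => ?_
  refine le_trans (Finset.sum_le_sum fun s _ => abs_add_le _ _) ?_
  rw [Finset.sum_add_distrib]
  refine le_trans (le_of_eq ?_) (h x)
  congr 1
  · rw [Finset.sum_eq_single x]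
    · simp [abs_of_nonneg (hq x)]
    · intro s _ hs
      rw [Matrix.diagonal_apply_ne _ (Ne.symm hs), abs_zero]
    · simp
  · simp only [Matrix.diagonal_mul, jumpMatrix, Matrix.of_apply]
    rw [Finset.sum_eq_single (k x)]
    · simp [abs_of_nonneg (hp x)]
    · intro s _ hs
      simp [hs]
    · simp

theorem norm_jumpMatrix_le (k : Fin N → Fin N) : ‖jumpMatrix k‖ ≤ 1 := by
  have := norm_diagonal_add_diagonal_mul_le (fun _ => 1) (fun _ => 0) k zero_le_one
    (by simp) (by simp) (by simp)
  simpa using this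

/-- The transition matrix of a jump attempt: with probability `exp (-y x)` stay at `x`, otherwise
move to `k x` and try a second move, half of the time being left on average. With the second move
the attempt agrees to second order with the chain that jumps along `k` at the rate `y`. -/
noncomputable def attempt (y : Fin N → ℝ) (k : Fin N → Fin N) : Matrix (Fin N) (Fin N) ℝ :=
  1 - Matrix.diagonal (fun x => 1 - Real.exp (-y x)) +
    Matrix.diagonal (fun x => 1 - Real.exp (-y x)) * (jumpMatrix k *
      (1 - Matrix.diagonal (fun x => 1 - Real.exp (-(y x / 2))) +
        Matrix.diagonal (fun x => 1 - Real.exp (-(y x / 2))) * jumpMatrix k))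

theorem norm_stay_or_jump_le (p : Fin N → ℝ) (k : Fin N → Fin N) (hp : ∀ x, 0 ≤ p x)
    (hp1 : ∀ x, p x ≤ 1) : ‖1 - Matrix.diagonal p + Matrix.diagonal p * jumpMatrix k‖ ≤ 1 := by
  have h := norm_diagonal_add_diagonal_mul_le p (fun x => 1 - p x) k zero_le_one hp
    (fun x => by linarith [hp1 x]) (fun x => by linarith)
  rwa [← Matrix.diagonal_one, Matrix.diagonal_sub]

theorem norm_diagonal_le {p : Fin N → ℝ} {c : ℝ} (hc : 0 ≤ c) (h : ∀ x, |p x| ≤ c) :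
    ‖Matrix.diagonal p‖ ≤ c := by
  rw [Matrix.linfty_opNorm_diagonal]
  exact (pi_norm_le_iff_of_nonneg hc).mpr h

theorem norm_attempt_le {y : Fin N → ℝ} (k : Fin N → Fin N) (hy0 : ∀ x, 0 ≤ y x) :
    ‖attempt y k‖ ≤ 1 := by
  have hp : ∀ z : ℝ, 0 ≤ z → 0 ≤ 1 - Real.exp (-z) := fun z hz => by
    have : Real.exp (-z) ≤ 1 := Real.exp_le_one_iff.mpr (by linarith)
    linarith
  have hp1 : ∀ z : ℝ, 1 - Real.exp (-z) ≤ 1 := fun z => by linarith [Real.exp_pos (-z)]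
  have hF := norm_stay_or_jump_le (fun x => 1 - Real.exp (-(y x / 2))) k
    (fun x => hp _ (by have := hy0 x; positivity)) (fun x => hp1 _)
  set F := 1 - Matrix.diagonal (fun x => 1 - Real.exp (-(y x / 2))) +
        Matrix.diagonal (fun x => 1 - Real.exp (-(y x / 2))) * jumpMatrix k
  have hMF : ‖jumpMatrix k * F‖ ≤ 1 :=
    (norm_mul_le _ _).trans (mul_le_one₀ (norm_jumpMatrix_le k) (norm_nonneg _) hF)
  rw [attempt]
  refine norm_le_of_sum_abs_row_le zero_le_one fun x => ?_
  set p : Fin N → ℝ := fun x => 1 - Real.exp (-y x)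
  have h1 : ∀ s, |(1 - Matrix.diagonal p + Matrix.diagonal p * (jumpMatrix k * F)) x s|
      ≤ (if x = s then 1 - p x else 0) + p x * |(jumpMatrix k * F) x s| := by
    intro s
    rw [Matrix.add_apply, Matrix.diagonal_mul, Matrix.sub_apply]
    refine (abs_add_le _ _).trans (add_le_add (le_of_eq ?_) (le_of_eq ?_))
    · split_ifs with hxs
      · subst hxs
        rw [Matrix.one_apply_eq, Matrix.diagonal_apply_eq, abs_of_nonneg (by linarith [hp1 (y x)])]
      · simp [hxs]
    · rw [abs_mul, abs_of_nonneg (hp _ (hy0 x))]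
  refine (Finset.sum_le_sum fun s _ => h1 s).trans ?_
  rw [Finset.sum_add_distrib, Finset.sum_ite_eq, if_pos (Finset.mem_univ _), ← Finset.mul_sum]
  have h2 := (sum_abs_row_le_norm (jumpMatrix k * F) x).trans hMF
  nlinarith [hp _ (hy0 x)]

variable [NeZero N]

theorem secondOrder_attempt {y : Fin N → ℝ} (k : Fin N → Fin N) {h : ℝ} (hy0 : ∀ x, 0 ≤ y x)
    (hyh : ∀ x, y x ≤ h) :
    SecondOrder (attempt y k) (Matrix.diagonal y * (jumpMatrix k - 1))
      ((2⁻¹ : ℝ) • ((Matrix.diagonal y * (jumpMatrix k - 1)) *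
        (Matrix.diagonal y * (jumpMatrix k - 1)))) (2 * h) := by
  have h0 : 0 ≤ h := (hy0 0).trans (hyh 0)
  refine SecondOrder.of_expansion ?_ (norm_jumpMatrix_le k) ?_ ?_ ?_ ?_
  · exact norm_diagonal_le h0 fun x => by rw [abs_of_nonneg (hy0 x)]; exact hyh x
  · rw [Matrix.diagonal_mul_diagonal, ← Matrix.diagonal_smul, Matrix.diagonal_sub,
      Matrix.diagonal_add]
    refine norm_diagonal_le (expTail_nonneg h0) fun x => ?_
    have hr := (SecondOrder.exp (x := -y x) (c := h)
      (by rw [norm_neg, Real.norm_of_nonneg (hy0 x)]; exact hyh x)).remainder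
    rw [← Real.exp_eq_exp_ℝ, Real.norm_eq_abs, ← abs_neg] at hr
    convert hr using 2
    simp
    ring
  · rw [← Matrix.diagonal_smul, Matrix.diagonal_sub]
    refine norm_diagonal_le (by positivity) fun x => ?_
    have h1 := Real.quadratic_le_exp_of_nonneg (show 0 ≤ y x / 2 by linarith [hy0 x])
    have h2 := Real.one_sub_le_exp_neg (y x / 2)
    have h3 : Real.exp (-(y x / 2)) ≤ 1 - y x / 2 + (y x / 2) ^ 2 / 2 := by
      set z := y x / 2 with hz
      have hz0 : 0 ≤ z := by have := hy0 x; positivity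
      rw [Real.exp_neg]
      refine inv_le_of_inv_le₀ (by nlinarith [sq_nonneg (1 - z)]) ?_
      refine le_trans ?_ h1
      rw [inv_le_iff_one_le_mul₀ (by nlinarith [sq_nonneg (1 - z)])]
      nlinarith [sq_nonneg (z ^ 2)]
    have h4 : y x ^ 2 ≤ h ^ 2 := pow_le_pow_left₀ (hy0 x) (hyh x) 2
    simp only [Pi.smul_apply, smul_eq_mul]
    rw [abs_le]
    constructor <;> nlinarith
  · refine norm_diagonal_le (by positivity) fun x => ?_
    have h2 := Real.one_sub_le_exp_neg (y x / 2)
    have h3 : Real.exp (-(y x / 2)) ≤ 1 := Real.exp_le_one_iff.mpr (by linarith [hy0 x])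
    rw [abs_of_nonneg (by linarith)]
    linarith [hyh x]
  · refine norm_stay_or_jump_le _ k (fun x => ?_) (fun x => ?_)
    · have h3 : Real.exp (-(y x / 2)) ≤ 1 := Real.exp_le_one_iff.mpr (by linarith [hy0 x])
      linarith
    · linarith [Real.exp_pos (-(y x / 2))]

/-- The generator of a Markov chain generates contractions for the row sum norm: after adding a
multiple of the identity it has nonnegative entries, and its row sums equal that multiple. -/
theorem norm_exp_generator_le {κ : Type*} (l : List κ) (y : κ → Fin N → ℝ)
    (k : κ → Fin N → Fin N) {h : ℝ} (hy0 : ∀ j x, 0 ≤ y j x) (hyh : ∀ j x, y j x ≤ h) (r : ℝ)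
    (hr : 0 ≤ r) (h0 : 0 ≤ h) :
    ‖NormedSpace.exp (r • (l.map fun j => Matrix.diagonal (y j) * (jumpMatrix (k j) - 1)).sum)‖
      ≤ 1 := by
  set S := (l.map fun j => Matrix.diagonal (y j) * (jumpMatrix (k j) - 1)).sum with hS
  have hb : ‖S + algebraMap ℝ _ (l.length * h)‖ ≤ l.length * h := by
    rw [hS]
    clear hS S
    induction l with
    | nil => simp
    | cons j l ih =>
      have hj := norm_diagonal_add_diagonal_mul_le (y j) (fun x => h - y j x) (k j) h0
        (hy0 j) (fun x => sub_nonneg.mpr (hyh j x)) (fun x => by linarith)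
      have e : Matrix.diagonal (fun x => h - y j x)
          = algebraMap ℝ (Matrix (Fin N) (Fin N) ℝ) h - Matrix.diagonal (y j) := by
        rw [Matrix.algebraMap_eq_diagonal, Matrix.diagonal_sub]
        rfl
      rw [e] at hj
      rw [List.map_cons, List.sum_cons, List.length_cons, Nat.cast_succ, add_mul, one_mul, map_add]
      refine le_trans (le_of_eq ?_) (norm_add_le_of_le ih hj)
      congr 1
      rw [mul_sub, mul_one]
      abel
  set lam : ℝ := l.length * h
  have hcomm : Commute (algebraMap ℝ (Matrix (Fin N) (Fin N) ℝ) (-(r * lam)))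
      (r • (S + algebraMap ℝ _ lam)) := Algebra.commutes _ _
  have e : r • S = algebraMap ℝ (Matrix (Fin N) (Fin N) ℝ) (-(r * lam))
      + r • (S + algebraMap ℝ _ lam) := by
    rw [smul_add, Algebra.smul_def r (algebraMap ℝ _ lam), ← map_mul, map_neg]
    abel
  have hscalar : NormedSpace.exp (algebraMap ℝ (Matrix (Fin N) (Fin N) ℝ) (-(r * lam)))
      = algebraMap ℝ _ (NormedSpace.exp (-(r * lam))) :=
    (NormedSpace.algebraMap_exp_comm _).symm
  rw [e, Matrix.exp_add_of_commute _ _ hcomm, hscalar, ← Algebra.smul_def, norm_smul,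
    ← Real.exp_eq_exp_ℝ, Real.norm_of_nonneg (Real.exp_pos _).le]
  have h2 : ‖NormedSpace.exp (r • (S + algebraMap ℝ _ lam))‖ ≤ Real.exp (r * lam) := by
    refine (norm_exp_le_exp _).trans (Real.exp_le_exp.mpr ?_)
    rw [norm_smul, Real.norm_of_nonneg hr]
    exact mul_le_mul_of_nonneg_left hb hr
  calc Real.exp (-(r * lam)) * _ ≤ Real.exp (-(r * lam)) * Real.exp (r * lam) :=
        mul_le_mul_of_nonneg_left h2 (Real.exp_pos _).le
    _ = 1 := by rw [← Real.exp_add]; simp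

theorem norm_prod_attempt_le {κ : Type*} (l : List κ) (y : κ → Fin N → ℝ)
    (k : κ → Fin N → Fin N) (hy0 : ∀ j x, 0 ≤ y j x) :
    ‖(l.map fun j => attempt (y j) (k j)).prod‖ ≤ 1 := by
  induction l with
  | nil => simp
  | cons j l ih =>
    rw [List.map_cons, List.prod_cons]
    exact (norm_mul_le _ _).trans (mul_le_one₀ (norm_attempt_le (k j) (hy0 j)) (norm_nonneg _) ih)

/-- The classical error of `r` repetitions of a palindromic product of jump attempts. -/
theorem norm_palindrome_attempt_pow_sub_exp_le {κ : Type*} (l : List κ) (y : κ → Fin N → ℝ)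
    (k : κ → Fin N → Fin N) {h : ℝ} (hy0 : ∀ j x, 0 ≤ y j x) (hyh : ∀ j x, y j x ≤ h) (h0 : 0 ≤ h)
    (r : ℕ) :
    ‖((l ++ l.reverse).map fun j => attempt (y j) (k j)).prod ^ r - NormedSpace.exp ((2 * r : ℝ) •
      (l.map fun j => Matrix.diagonal (y j) * (jumpMatrix (k j) - 1)).sum)‖
      ≤ r * (2 * expTail (2 * l.length * (2 * h))) := by
  have h1 := norm_palindrome_sub_exp_le (fun j => attempt (y j) (k j))
    (fun j => Matrix.diagonal (y j) * (jumpMatrix (k j) - 1))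
    (fun j => secondOrder_attempt (k j) (hy0 j) (hyh j)) l
  set S := (l.map fun j => Matrix.diagonal (y j) * (jumpMatrix (k j) - 1)).sum with hS
  have h2 : NormedSpace.exp ((2 * r : ℝ) • S) = NormedSpace.exp ((2 : ℝ) • S) ^ r := by
    rw [← Matrix.exp_nsmul, ← Nat.cast_smul_eq_nsmul ℝ, smul_smul, mul_comm]
  rw [h2]
  refine (norm_pow_sub_pow_le ?_ (norm_exp_generator_le l y k hy0 hyh 2 (by norm_num) h0) r).trans
    (mul_le_mul_of_nonneg_left h1 (Nat.cast_nonneg r))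
  exact norm_prod_attempt_le _ y k hy0

end JumpAttempt

/-! ### Elementary operations on basis states -/

section Gates

variable {N d : ℕ} {a : Matrix (Fin N) (Fin N) ℝ} (B : BlackBox a d) {Q R : Type} [DecidableEq Q]

/-- The linear map that a list of elementary operations implements. -/
noncomputable def exec : List (Gate N d Q R) → (Config Q R →₀ ℂ) →ₗ[ℂ] (Config Q R →₀ ℂ)
  | [] => LinearMap.id
  | g :: gs => (exec gs).comp (g.apply B)

theorem foldl_apply_eq_exec (gs : List (Gate N d Q R)) (ψ : Config Q R →₀ ℂ) :
    gs.foldl (fun ψ g => g.apply B ψ) ψ = exec B gs ψ := by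
  induction gs generalizing ψ with
  | nil => rfl
  | cons g gs ih => rw [List.foldl_cons, ih]; rfl

@[simp]
theorem exec_nil (ψ : Config Q R →₀ ℂ) : exec B [] ψ = ψ := rfl

theorem exec_cons (g : Gate N d Q R) (gs : List (Gate N d Q R)) (ψ : Config Q R →₀ ℂ) :
    exec B (g :: gs) ψ = exec B gs (g.apply B ψ) := rfl

theorem exec_append (gs gs' : List (Gate N d Q R)) (ψ : Config Q R →₀ ℂ) :
    exec B (gs ++ gs') ψ = exec B gs' (exec B gs ψ) := by
  induction gs generalizing ψ with
  | nil => rfl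
  | cons g gs ih => rw [List.cons_append, exec_cons, exec_cons, ih]

theorem apply_single_one (g : Gate N d Q R) (c : Config Q R) :
    g.apply B (Finsupp.single c 1) = g.onBasis B c := by
  rw [Gate.apply, Finsupp.linearCombination_single, one_smul]

theorem apply_single (g : Gate N d Q R) (c : Config Q R) (z : ℂ) :
    g.apply B (Finsupp.single c z) = z • g.onBasis B c := by
  rw [Gate.apply, Finsupp.linearCombination_single]

/-- The two-qubit matrix of the operation `M` on the second qubit, controlled by the first. -/
def controlledMatrix (M : Matrix Bool Bool ℂ) : Matrix (Bool × Bool) (Bool × Bool) ℂ :=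
  Matrix.of fun p q => if p.1 = q.1 then (if q.1 then M else 1) p.2 q.2 else 0

theorem controlledMatrix_mem (M : Matrix.unitaryGroup Bool ℂ) :
    controlledMatrix (M : Matrix Bool Bool ℂ) ∈ Matrix.unitaryGroup (Bool × Bool) ℂ := by
  rw [Matrix.mem_unitaryGroup_iff]
  have hM := Matrix.mem_unitaryGroup_iff.mp M.2
  have h : ∀ b : Bool, (if b then (M : Matrix Bool Bool ℂ) else 1) *
      star (if b then (M : Matrix Bool Bool ℂ) else 1) = 1 := by
    intro b
    cases b <;> simp [hM]
  ext ⟨p1, p2⟩ ⟨q1, q2⟩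
  rw [Matrix.mul_apply, Fintype.sum_prod_type, Finset.sum_eq_single p1]
  · have h1 := congrFun (congrFun (h p1) p2) q2
    rw [Matrix.mul_apply] at h1
    by_cases hpq : p1 = q1
    · subst hpq
      simp only [controlledMatrix, Matrix.of_apply, Matrix.star_apply, if_true] at h1 ⊢
      rw [h1]
      simp [Matrix.one_apply]
    · have hqp : ¬ q1 = p1 := fun h => hpq h.symm
      simp [controlledMatrix, Matrix.star_apply, hpq, hqp]
  · intro b _ hb
    simp [controlledMatrix, Ne.symm hb]
  · simp

/-- The elementary operation `M` on the qubit `j`, controlled by the qubit `i`. -/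
def cgate (i j : Q) (h : i ≠ j) (M : Matrix.unitaryGroup Bool ℂ) : Gate N d Q R :=
  .pair i j h ⟨controlledMatrix (M : Matrix Bool Bool ℂ), controlledMatrix_mem M⟩

/-- The image of a basis state under the one-qubit matrix `M` on the qubit `j`. -/
noncomputable def act (j : Q) (M : Matrix Bool Bool ℂ) (c : Config Q R) : Config Q R →₀ ℂ :=
  ∑ β, Finsupp.single (Function.update c.1 j β, c.2) (M β (c.1 j))

theorem act_one (j : Q) (c : Config Q R) : act j 1 c = Finsupp.single c 1 := by
  rw [act, Finset.sum_eq_single (c.1 j)]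
  · simp
  · intro b _ hb
    simp [hb]
  · simp

theorem cgate_onBasis (i j : Q) (h : i ≠ j) (M : Matrix.unitaryGroup Bool ℂ) (c : Config Q R) :
    (cgate i j h M : Gate N d Q R).onBasis B c
      = act j (if c.1 i then (M : Matrix Bool Bool ℂ) else 1) c := by
  rw [cgate, Gate.onBasis, Fintype.sum_prod_type, Finset.sum_eq_single (c.1 i)]
  · simp [controlledMatrix, act]
  · intro b _ hb
    simp [controlledMatrix, hb]
  · simp

theorem apply_cgate_act (i j : Q) (h : i ≠ j) (M : Matrix.unitaryGroup Bool ℂ)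
    (M' : Matrix Bool Bool ℂ) (c : Config Q R) :
    (cgate i j h M : Gate N d Q R).apply B (act j M' c)
      = act j ((if c.1 i then (M : Matrix Bool Bool ℂ) else 1) * M') c := by
  conv_lhs => rw [act]
  rw [map_sum]
  simp only [apply_single, cgate_onBasis, Function.update_of_ne h]
  simp only [act, Finset.smul_sum, Function.update_self, Function.update_idem,
    Finsupp.smul_single, smul_eq_mul, Matrix.mul_apply, Finsupp.single_finsetSum]
  rw [Finset.sum_comm]
  refine Finset.sum_congr rfl fun β _ => Finset.sum_congr rfl fun β' _ => ?_
  rw [mul_comm]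

/-- The Pauli matrix that flips a bit. -/
def flipMatrix : Matrix Bool Bool ℂ := Matrix.of fun i j => if i = j then 0 else 1

/-- A square root of the bit flip. -/
noncomputable def sqrtFlip : Matrix Bool Bool ℂ :=
  Matrix.of fun i j => if i = j then (1 + Complex.I) / 2 else (1 - Complex.I) / 2

theorem sqrtFlip_mul_sqrtFlip : sqrtFlip * sqrtFlip = flipMatrix := by
  ext i j
  cases i <;> cases j <;> simp [sqrtFlip, flipMatrix, Matrix.mul_apply] <;> ring_nf <;>
    simp [Complex.I_sq] <;> norm_num

theorem sqrtFlip_mul_star : sqrtFlip * star sqrtFlip = 1 := by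
  have h2 : (starRingEnd ℂ) 2 = 2 := map_ofNat _ 2
  ext i j
  cases i <;> cases j <;> simp [sqrtFlip, Matrix.mul_apply, Matrix.star_apply] <;> ring_nf <;>
    simp [Complex.I_sq, h2] <;> norm_num

theorem star_sqrtFlip_mul : star sqrtFlip * sqrtFlip = 1 :=
  mul_eq_one_comm.mp sqrtFlip_mul_star

theorem flipMatrix_mem : flipMatrix ∈ Matrix.unitaryGroup Bool ℂ := by
  rw [Matrix.mem_unitaryGroup_iff]
  ext i j
  cases i <;> cases j <;> simp [flipMatrix, Matrix.mul_apply, Matrix.star_apply]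

/-- The square root of the bit flip as a unitary. -/
noncomputable def sqrtFlipU : Matrix.unitaryGroup Bool ℂ :=
  ⟨sqrtFlip, Matrix.mem_unitaryGroup_iff.mpr sqrtFlip_mul_star⟩

/-- The controlled bit flip. -/
def cx (i j : Q) (h : i ≠ j) : Gate N d Q R := cgate i j h ⟨flipMatrix, flipMatrix_mem⟩

theorem act_flip (j : Q) (b : Bool) (c : Config Q R) :
    act j (if b then flipMatrix else 1) c
      = Finsupp.single (Function.update c.1 j (xor (c.1 j) b), c.2) 1 := by
  cases b
  · simpa using act_one j c
  · rw [act, Finset.sum_eq_single (xor (c.1 j) true)]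
    · simp [flipMatrix]
    · intro b _ hb
      have : b = c.1 j := by revert hb; cases b <;> cases c.1 j <;> simp
      simp [flipMatrix, this]
    · simp

theorem cx_onBasis (i j : Q) (h : i ≠ j) (c : Config Q R) :
    (cx i j h : Gate N d Q R).onBasis B c
      = Finsupp.single (Function.update c.1 j (xor (c.1 j) (c.1 i)), c.2) 1 := by
  rw [cx, cgate_onBasis, act_flip]

theorem apply_cx_act (i j k : Q) (h : i ≠ j) (hik : i ≠ k) (hjk : j ≠ k) (M : Matrix Bool Bool ℂ)
    (c : Config Q R) : (cx i j h : Gate N d Q R).apply B (act k M c)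
      = act k M (Function.update c.1 j (xor (c.1 j) (c.1 i)), c.2) := by
  conv_lhs => rw [act]
  rw [map_sum, act]
  refine Finset.sum_congr rfl fun β _ => ?_
  rw [apply_single, cx_onBasis]
  simp only [Function.update_of_ne hik, Function.update_of_ne hjk, Function.update_of_ne hjk.symm]
  rw [Finsupp.smul_single, smul_eq_mul, mul_one, Function.update_comm hjk]

/-- The doubly controlled bit flip, composed of two-qubit operations. -/
noncomputable def toffoli (b p z : Q) (hbp : b ≠ p) (hbz : b ≠ z) (hpz : p ≠ z) :
    List (Gate N d Q R) :=
  [cgate p z hpz sqrtFlipU, cx b p hbp, cgate p z hpz (star sqrtFlipU), cx b p hbp,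
    cgate b z hbz sqrtFlipU]

theorem exec_toffoli (b p z : Q) (hbp : b ≠ p) (hbz : b ≠ z) (hpz : p ≠ z) (c : Config Q R) :
    exec B (toffoli b p z hbp hbz hpz) (Finsupp.single c 1)
      = Finsupp.single (Function.update c.1 z (xor (c.1 z) (c.1 b && c.1 p)), c.2) 1 := by
  rw [toffoli, exec_cons, ← act_one z c, apply_cgate_act, exec_cons,
    apply_cx_act B b p z hbp hbz hpz, exec_cons, apply_cgate_act, exec_cons,
    apply_cx_act B b p z hbp hbz hpz, exec_cons, apply_cgate_act, exec_nil]
  simp only [Function.update_self, Function.update_of_ne hbp, Function.update_idem]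
  have hc : Function.update c.1 p (xor (xor (c.1 p) (c.1 b)) (c.1 b)) = c.1 := by
    rw [Bool.xor_assoc, Bool.xor_self, Bool.xor_false, Function.update_eq_self]
  rw [hc, ← act_flip]
  congr 1
  have h1 : (sqrtFlipU : Matrix Bool Bool ℂ) = sqrtFlip := rfl
  have h2 : ((star sqrtFlipU : Matrix.unitaryGroup Bool ℂ) : Matrix Bool Bool ℂ)
    = star sqrtFlip := rfl
  rw [h1, h2]
  cases c.1 b <;> cases c.1 p <;>
    simp [sqrtFlip_mul_sqrtFlip, sqrtFlip_mul_star, star_sqrtFlip_mul]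

/-- A family of circuits that each add a function of the other qubits to one of the qubits
`Z i`. -/
theorem exec_flatMap_xor {w : ℕ} (Z : Fin w → Q) (hZ : Function.Injective Z)
    (φ : Fin w → (Q → Bool) → Bool) (hφ : ∀ i i' c β, φ i (Function.update c (Z i') β) = φ i c)
    (G : Fin w → List (Gate N d Q R))
    (hG : ∀ i (c : Config Q R), exec B (G i) (Finsupp.single c 1)
      = Finsupp.single (Function.update c.1 (Z i) (xor (c.1 (Z i)) (φ i c.1)), c.2) 1)
    (c : Config Q R) :
    exec B ((List.finRange w).flatMap G) (Finsupp.single c 1)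
      = Finsupp.single (Function.extend Z (fun i => xor (c.1 (Z i)) (φ i c.1)) c.1, c.2) 1 := by
  have key : ∀ (l : List (Fin w)), l.Nodup → ∀ c : Config Q R,
      exec B (l.flatMap G) (Finsupp.single c 1) = Finsupp.single (Function.extend Z
        (fun i => if i ∈ l then xor (c.1 (Z i)) (φ i c.1) else c.1 (Z i)) c.1, c.2) 1 := by
    intro l
    induction l with
    | nil =>
      intro _ c
      rw [List.flatMap_nil, exec_nil]
      congr 1
      refine Prod.ext ?_ rfl
      funext q
      by_cases hq : ∃ i, Z i = q
      · obtain ⟨i, rfl⟩ := hq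
        simp [hZ.extend_apply]
      · dsimp only
        rw [Function.extend_apply' _ _ _ hq]
    | cons i l ih =>
      intro hl c
      rw [List.nodup_cons] at hl
      rw [List.flatMap_cons, exec_append, hG, ih hl.2]
      congr 1
      refine Prod.ext ?_ rfl
      funext q
      by_cases hq : ∃ i', Z i' = q
      · obtain ⟨i', rfl⟩ := hq
        simp only [hZ.extend_apply, hφ]
        by_cases hi : i' = i
        · subst hi
          simp [hl.1]
        · have : Z i' ≠ Z i := fun h => hi (hZ h)
          simp [hi, this]
      · dsimp only
        rw [Function.extend_apply' _ _ _ hq, Function.extend_apply' _ _ _ hq,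
          Function.update_of_ne]
        rintro rfl
        exact hq ⟨i, rfl⟩
  rw [key _ (List.nodup_finRange w)]
  simp

end Gates

section Rotation

/-- The amplitude for staying during a time `s` at a rate `v`. The absolute values only serve to
make it an amplitude for all real arguments. -/
noncomputable def stayAmp (s v : ℝ) : ℝ := Real.exp (-(|v| * |s|))

/-- The amplitude for leaving. -/
noncomputable def leaveAmp (s v : ℝ) : ℝ := √(1 - stayAmp s v ^ 2)

theorem stayAmp_sq_add_leaveAmp_sq (s v : ℝ) : stayAmp s v ^ 2 + leaveAmp s v ^ 2 = 1 := by
  have h0 : 0 < stayAmp s v := Real.exp_pos _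
  have h1 : stayAmp s v ≤ 1 := Real.exp_le_one_iff.mpr (by
    have := mul_nonneg (abs_nonneg v) (abs_nonneg s)
    linarith)
  rw [leaveAmp, Real.sq_sqrt (by nlinarith)]
  ring

/-- The rotation with `|0⟩ ↦ stayAmp |0⟩ + leaveAmp |1⟩`. -/
noncomputable def rotMatrix (s v : ℝ) : Matrix Bool Bool ℂ :=
  Matrix.of fun i j => if i = j then (stayAmp s v : ℂ)
    else if i then (leaveAmp s v : ℂ) else -(leaveAmp s v : ℂ)

theorem rotMatrix_mem (s v : ℝ) : rotMatrix s v ∈ Matrix.unitaryGroup Bool ℂ := by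
  rw [Matrix.mem_unitaryGroup_iff]
  have h : ((stayAmp s v : ℂ)) ^ 2 + (leaveAmp s v : ℂ) ^ 2 = 1 := by
    exact_mod_cast stayAmp_sq_add_leaveAmp_sq s v
  ext i j
  cases i <;> cases j <;> simp [rotMatrix, Matrix.mul_apply, Matrix.star_apply] <;>
    first | (rw [← h]; ring) | ring

/-- The rotation as a function of the rate. -/
noncomputable def rot (s v : ℝ) : Matrix.unitaryGroup Bool ℂ := ⟨rotMatrix s v, rotMatrix_mem s v⟩

end Rotation

/-! ### Layout of the memory and composite operations -/

section Layout

/-- The ancilla qubits of a sequence of `T` jump attempts: the answers of the black box in `d`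
slots and, for every attempt, two flags and two registers that hold an index. -/
abbrev Ancilla (w d T : ℕ) := (Fin d × Fin w) ⊕ (Fin T × Bool) ⊕ ((Fin T × Bool) × Fin w)

/-- All qubits: the system and the ancillas. -/
abbrev Wire (w d T : ℕ) := Fin w ⊕ Ancilla w d T

variable {w d T : ℕ} {Q : Type} (e : Wire w d T ≃ Q)

/-- The bit assignment with contents `x` of the system, `p` of the answer slots, `fl` of the flags
and `rg` of the registers. -/
def wires (x : Fin w → Bool) (p : Fin d × Fin w → Bool) (fl : Fin T × Bool → Bool)
    (rg : Fin T × Bool → Fin w → Bool) : Q → Bool :=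
  fun q => Sum.elim x (Sum.elim p (Sum.elim fl fun y => rg y.1 y.2)) (e.symm q)

variable (x : Fin w → Bool) (p : Fin d × Fin w → Bool) (fl : Fin T × Bool → Bool)
  (rg : Fin T × Bool → Fin w → Bool)

@[simp]
theorem wires_sys (i : Fin w) : wires e x p fl rg (e (.inl i)) = x i := by simp [wires]

@[simp]
theorem wires_pos (q : Fin d × Fin w) : wires e x p fl rg (e (.inr (.inl q))) = p q := by
  simp [wires]

@[simp]
theorem wires_flag (k : Fin T × Bool) : wires e x p fl rg (e (.inr (.inr (.inl k)))) = fl k := by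
  simp [wires]

@[simp]
theorem wires_reg (y : (Fin T × Bool) × Fin w) :
    wires e x p fl rg (e (.inr (.inr (.inr y)))) = rg y.1 y.2 := by
  simp [wires]

theorem update_wires_flag [DecidableEq Q] (k : Fin T × Bool) (β : Bool) :
    Function.update (wires e x p fl rg) (e (.inr (.inr (.inl k)))) β
      = wires e x p (Function.update fl k β) rg := by
  funext q
  obtain ⟨y, rfl⟩ := e.surjective q
  rcases y with i | q | k' | y <;> simp [Function.update_apply]

/-- The qubits of a register as an embedding. -/
def regEmb (k : Fin T × Bool) : Fin w ↪ Q :=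
  ⟨fun i => e (.inr (.inr (.inr (k, i)))), fun i i' h => by simpa using h⟩

/-- The qubits of the system as an embedding. -/
def sysEmb : Fin w ↪ Q := ⟨fun i => e (.inl i), fun i i' h => by simpa using h⟩

/-- The qubits of the answer slots as an embedding. -/
def posEmb : Fin d × Fin w ↪ Q := ⟨fun q => e (.inr (.inl q)), fun i i' h => by simpa using h⟩

theorem regEmb_apply (k : Fin T × Bool) (i : Fin w) :
    regEmb e k i = e (.inr (.inr (.inr (k, i)))) := rfl

theorem sysEmb_apply (i : Fin w) : (sysEmb e : Fin w ↪ Q) i = e (.inl i) := rfl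

theorem posEmb_apply (q : Fin d × Fin w) : (posEmb e : Fin d × Fin w ↪ Q) q = e (.inr (.inl q)) :=
  rfl

theorem extend_wires_reg (k : Fin T × Bool) (g : Fin w → Bool) :
    Function.extend (regEmb e k) g (wires e x p fl rg)
      = wires e x p fl (Function.update rg k g) := by
  funext q
  by_cases hq : ∃ i, regEmb e k i = q
  · obtain ⟨i, rfl⟩ := hq
    rw [(regEmb e k).injective.extend_apply]
    simp [regEmb_apply]
  · rw [Function.extend_apply' _ _ _ hq]
    obtain ⟨y, rfl⟩ := e.surjective q
    rcases y with i | q | k' | ⟨k', i⟩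
    · simp
    · simp
    · simp
    · have : k' ≠ k := by
        rintro rfl
        exact hq ⟨i, rfl⟩
      simp [this]

theorem extend_wires_sys (g : Fin w → Bool) :
    Function.extend (sysEmb e) g (wires e x p fl rg) = wires e g p fl rg := by
  funext q
  by_cases hq : ∃ i, sysEmb e i = q
  · obtain ⟨i, rfl⟩ := hq
    rw [(sysEmb e).injective.extend_apply]
    simp [sysEmb_apply]
  · rw [Function.extend_apply' _ _ _ hq]
    obtain ⟨y, rfl⟩ := e.surjective q
    rcases y with i | q | k' | ⟨k', i⟩
    · exact absurd ⟨i, rfl⟩ hq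
    · simp
    · simp
    · simp

end Layout

section Operations

theorem bits_injective {N : ℕ} : Function.Injective (bits (N := N)) := by
  intro x y h
  apply Fin.ext
  apply Nat.eq_of_testBit_eq
  intro i
  by_cases hi : i < width N
  · exact congrFun h ⟨i, hi⟩
  · have hN : N ≤ 2 ^ i := (Nat.le_pow_clog one_lt_two N).trans
      (Nat.pow_le_pow_right two_pos (not_lt.mp hi))
    rw [Nat.testBit_lt_two_pow (x.2.trans_le hN), Nat.testBit_lt_two_pow (y.2.trans_le hN)]

theorem bits_zero {N : ℕ} [NeZero N] : bits (0 : Fin N) = fun _ => false := by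
  funext i
  simp [bits]

variable {N d T : ℕ} {a : Matrix (Fin N) (Fin N) ℝ} (B : BlackBox a d)

/-- The position in slot `j` of the column `u`, or `0` if the slot is unused. -/
def slotPos [NeZero N] (j : Fin d) (u : Fin N) : Fin N := (B.col u j).getD 0

/-- The entry in slot `j` of the column `u`, or `0` if the slot is unused. -/
def slotRate (j : Fin d) (u : Fin N) : ℝ := (B.col u j).elim 0 fun k => a k u

theorem answer_col [NeZero N] (u : Fin N) (j : Fin d) :
    B.answer true u j = (bits (slotPos B j u), slotRate B j u) := by
  rw [BlackBox.answer, if_pos rfl, slotPos, slotRate]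
  cases B.col u j
  · simp [bits_zero]
  · simp

variable {Q : Type} [DecidableEq Q] (e : Wire (width N) d T ≃ Q)

theorem apply_query [NeZero N] (inv : Bool) (addr : Fin (width N) ↪ Q)
    (hdisj : ∀ i q, addr i ≠ posEmb e q) (u : Fin N) (x p fl rg) (v : Fin d → ℝ)
    (hu : ∀ i, wires e x p fl rg (addr i) = bits u i) :
    (Gate.query true inv addr (posEmb e) (.refl _) hdisj).apply B
        (Finsupp.single (wires e x p fl rg, v) 1)
      = Finsupp.single (wires e x (fun q => xor (p q) (bits (slotPos B q.1 u) q.2)) fl rg,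
          fun j => v j + (if inv then -1 else 1) * slotRate B j u) 1 := by
  rw [apply_single_one, Gate.onBasis]
  congr 1
  have hex : ∃ y : Fin N, bits y = fun i => wires e x p fl rg (addr i) :=
    ⟨u, funext fun i => (hu i).symm⟩
  have hch : hex.choose = u := by
    apply bits_injective
    rw [hex.choose_spec]
    exact funext hu
  rw [queryConfig, dif_pos hex, hch]
  simp only [answer_col]
  refine Prod.ext ?_ ?_
  · funext q
    by_cases hq : ∃ q', posEmb e q' = q
    · obtain ⟨q', rfl⟩ := hq
      dsimp only
      rw [(posEmb e).injective.extend_apply]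
      simp [posEmb_apply]
    · dsimp only
      rw [Function.extend_apply' _ _ _ hq]
      obtain ⟨y, rfl⟩ := e.surjective q
      rcases y with i | q | k' | ⟨k', i⟩
      · simp
      · exact absurd ⟨q, rfl⟩ hq
      · simp
      · simp
  · funext j
    dsimp only
    have := (Function.Embedding.refl (Fin d)).injective.extend_apply
      (fun j => slotRate B j u) (fun _ => 0) j
    rw [Function.Embedding.refl_apply] at this
    rw [this]

theorem apply_rot (r : Fin d) (k : Fin T × Bool) (s : ℝ) (x p fl rg) (v : Fin d → ℝ)
    (hk : fl k = false) :
    (Gate.ctrl r (e (.inr (.inr (.inl k)))) (rot s) : Gate N d Q (Fin d)).apply B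
        (Finsupp.single (wires e x p fl rg, v) 1)
      = ∑ β : Bool, ((if β then leaveAmp s (v r) else stayAmp s (v r) : ℝ) : ℂ) •
          Finsupp.single (wires e x p (Function.update fl k β) rg, v) 1 := by
  rw [apply_single_one, Gate.onBasis]
  refine Finset.sum_congr rfl fun β _ => ?_
  simp only [wires_flag, hk, update_wires_flag, Finsupp.smul_single, smul_eq_mul, mul_one]
  congr 1
  cases β <;> simp [rot, rotMatrix]

/-- Add the answer in slot `j` to a register, controlled by a flag. -/
noncomputable def copySlot (j : Fin d) (k : Fin T × Bool) : List (Gate N d Q (Fin d)) :=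
  (List.finRange (width N)).flatMap fun i =>
    toffoli (e (.inr (.inr (.inl k)))) (e (.inr (.inl (j, i)))) (regEmb e k i)
      (by simp) (by simp [regEmb_apply]) (by simp [regEmb_apply])

theorem exec_copySlot (j : Fin d) (k : Fin T × Bool) (x p fl rg) (v : Fin d → ℝ) :
    exec B (copySlot e j k) (Finsupp.single (wires e x p fl rg, v) 1)
      = Finsupp.single (wires e x p fl
          (Function.update rg k fun i => xor (rg k i) (fl k && p (j, i))), v) 1 := by
  rw [copySlot, exec_flatMap_xor B (regEmb e k) (regEmb e k).injective
    (fun i c => c (e (.inr (.inr (.inl k)))) && c (e (.inr (.inl (j, i)))))]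
  · dsimp only
    rw [extend_wires_reg]
    simp [regEmb_apply]
  · intro i i' c β
    simp [regEmb_apply]
  · intro i c
    exact exec_toffoli B ..

/-- Add the content of the qubits `Y` to the qubits `Z`. -/
def addQubits (Y Z : Fin (width N) ↪ Q) (h : ∀ i i', Y i ≠ Z i') : List (Gate N d Q (Fin d)) :=
  (List.finRange (width N)).flatMap fun i => [cx (Y i) (Z i) (h i i)]

theorem exec_addQubits (Y Z : Fin (width N) ↪ Q) (h : ∀ i i', Y i ≠ Z i')
    (c : Config Q (Fin d)) :
    exec B (addQubits Y Z h) (Finsupp.single c 1)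
      = Finsupp.single (Function.extend Z (fun i => xor (c.1 (Z i)) (c.1 (Y i))) c.1, c.2) 1 := by
  rw [addQubits, exec_flatMap_xor B Z Z.injective (fun i c => c (Y i))]
  · intro i i' c β
    simp [h i i']
  · intro i c
    rw [exec_cons, exec_nil, apply_single_one, cx_onBasis]

/-- Swap the qubits `Y` with the qubits `Z`, controlled by the qubit `b`. -/
noncomputable def condSwap (b : Q) (Y Z : Fin (width N) ↪ Q) (h : ∀ i i', Y i ≠ Z i')
    (hY : ∀ i, b ≠ Y i) (hZ : ∀ i, b ≠ Z i) : List (Gate N d Q (Fin d)) :=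
  addQubits Z Y (fun i i' => (h i' i).symm) ++
    ((List.finRange (width N)).flatMap fun i => toffoli b (Y i) (Z i) (hY i) (hZ i) (h i i)) ++
    addQubits Z Y (fun i i' => (h i' i).symm)

theorem exec_condSwap (b : Q) (Y Z : Fin (width N) ↪ Q) (h : ∀ i i', Y i ≠ Z i')
    (hY : ∀ i, b ≠ Y i) (hZ : ∀ i, b ≠ Z i) (c : Config Q (Fin d)) :
    exec B (condSwap b Y Z h hY hZ) (Finsupp.single c 1)
      = Finsupp.single (Function.extend Y (fun i => if c.1 b then c.1 (Z i) else c.1 (Y i))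
          (Function.extend Z (fun i => if c.1 b then c.1 (Y i) else c.1 (Z i)) c.1), c.2) 1 := by
  have hbY : ¬ ∃ i, Y i = b := fun ⟨i, hi⟩ => hY i hi.symm
  have hZY : ∀ i, ¬ ∃ i', Y i' = Z i := fun i ⟨i', hi⟩ => h i' i hi
  have hYZ : ∀ i, ¬ ∃ i', Z i' = Y i := fun i ⟨i', hi⟩ => h i i' hi.symm
  rw [condSwap, exec_append, exec_append, exec_addQubits, exec_flatMap_xor B Z Z.injective
    (fun i c => c b && c (Y i)), exec_addQubits]
  · congr 1
    refine Prod.ext ?_ rfl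
    funext q
    by_cases hqY : ∃ i, Y i = q
    · obtain ⟨i, rfl⟩ := hqY
      simp only [Y.injective.extend_apply, Z.injective.extend_apply,
        Function.extend_apply' _ _ _ (hYZ _), Function.extend_apply' _ _ _ (hZY _),
        Function.extend_apply' _ _ _ hbY]
      cases c.1 b <;> cases c.1 (Y i) <;> cases c.1 (Z i) <;> rfl
    · dsimp only
      rw [Function.extend_apply' _ _ _ hqY, Function.extend_apply' _ _ _ hqY]
      by_cases hqZ : ∃ i, Z i = q
      · obtain ⟨i, rfl⟩ := hqZ
        simp only [Y.injective.extend_apply, Z.injective.extend_apply,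
          Function.extend_apply' _ _ _ (hZY _), Function.extend_apply' _ _ _ hbY]
        cases c.1 b <;> cases c.1 (Y i) <;> cases c.1 (Z i) <;> rfl
      · rw [Function.extend_apply' _ _ _ hqZ, Function.extend_apply' _ _ _ hqZ,
          Function.extend_apply' _ _ _ hqY]
  · intro i i' c β
    simp [h i i', hZ i']
  · intro i c
    exact exec_toffoli B ..

end Operations

/-! ### The circuit of a jump attempt -/

section AttemptCircuit

variable {N d T : ℕ} {Q : Type} (e : Wire (width N) d T ≃ Q)

theorem sysEmb_ne_posEmb (i : Fin (width N)) (q : Fin d × Fin (width N)) :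
    sysEmb e i ≠ posEmb e q := by simp [sysEmb_apply, posEmb_apply]

theorem regEmb_ne_posEmb (k : Fin T × Bool) (i : Fin (width N)) (q : Fin d × Fin (width N)) :
    regEmb e k i ≠ posEmb e q := by simp [regEmb_apply, posEmb_apply]

theorem sysEmb_ne_regEmb (k : Fin T × Bool) (i i' : Fin (width N)) :
    sysEmb e i ≠ regEmb e k i' := by simp [sysEmb_apply, regEmb_apply]

theorem regEmb_ne_regEmb {k k' : Fin T × Bool} (h : k ≠ k') (i i' : Fin (width N)) :
    regEmb e k i ≠ regEmb e k' i' := by simp [regEmb_apply, h]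

theorem flag_ne_sysEmb (k : Fin T × Bool) (i : Fin (width N)) :
    e (.inr (.inr (.inl k))) ≠ sysEmb e i := by simp [sysEmb_apply]

theorem flag_ne_regEmb (k k' : Fin T × Bool) (i : Fin (width N)) :
    e (.inr (.inr (.inl k))) ≠ regEmb e k' i := by simp [regEmb_apply]

/-- Draw a flag whose distribution is given by the rate in slot `j` of the column `addr`, and if it
is set, write the position in this slot to a register. The answer of the black box is erased. -/
noncomputable def tryMove (addr : Fin (width N) ↪ Q) (hdisj : ∀ i q, addr i ≠ posEmb e q)
    (j : Fin d) (k : Fin T × Bool) (s : ℝ) : List (Gate N d Q (Fin d)) :=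
  [.query true false addr (posEmb e) (.refl _) hdisj,
    .ctrl j (e (.inr (.inr (.inl k)))) (rot s)] ++ copySlot e j k ++
    [.query true true addr (posEmb e) (.refl _) hdisj]

/-- The circuit of the jump attempt number `n`, for the slot `j` and the time `s`. The second move
is tried from the index in the first register. If the first flag is not set, this index is `0`, so
that the second move reveals nothing about the system, and the final swap is not carried out. -/
noncomputable def attemptGates (n : Fin T) (j : Fin d) (s : ℝ) : List (Gate N d Q (Fin d)) :=
  tryMove e (sysEmb e) (sysEmb_ne_posEmb e) j (n, false) s ++
    tryMove e (regEmb e (n, false)) (regEmb_ne_posEmb e _) j (n, true) (s / 2) ++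
    condSwap (e (.inr (.inr (.inl (n, true))))) (regEmb e (n, false)) (regEmb e (n, true))
      (regEmb_ne_regEmb e (by simp)) (flag_ne_regEmb e _ _) (flag_ne_regEmb e _ _) ++
    condSwap (e (.inr (.inr (.inl (n, false))))) (sysEmb e) (regEmb e (n, false))
      (sysEmb_ne_regEmb e _) (flag_ne_sysEmb e _) (flag_ne_regEmb e _ _)

theorem countP_query_tryMove (addr : Fin (width N) ↪ Q) (hdisj : ∀ i q, addr i ≠ posEmb e q)
    (j : Fin d) (k : Fin T × Bool) (s : ℝ) :
    (tryMove e addr hdisj j k s).countP (fun g => g.isQuery) = 2 ∧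
    (tryMove e addr hdisj j k s).countP (fun g => !g.isQuery) = 5 * width N + 1 := by
  constructor
  · simp [tryMove, copySlot, toffoli, List.countP_append, List.countP_flatMap,
      Gate.isQuery, cgate, cx, Function.comp_def]
  · simp [tryMove, copySlot, toffoli, List.countP_append, List.countP_flatMap,
      Gate.isQuery, cgate, cx, Function.comp_def]
    ring

theorem countP_query_condSwap (b : Q) (Y Z : Fin (width N) ↪ Q) (h : ∀ i i', Y i ≠ Z i')
    (hY : ∀ i, b ≠ Y i) (hZ : ∀ i, b ≠ Z i) :
    (condSwap b Y Z h hY hZ : List (Gate N d Q (Fin d))).countP (fun g => g.isQuery) = 0 ∧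
    (condSwap b Y Z h hY hZ : List (Gate N d Q (Fin d))).countP (fun g => !g.isQuery)
      = 7 * width N := by
  constructor
  · simp [condSwap, addQubits, toffoli, List.countP_append, List.countP_flatMap,
      Gate.isQuery, cgate, cx, Function.comp_def]
  · simp [condSwap, addQubits, toffoli, List.countP_append, List.countP_flatMap,
      Gate.isQuery, cgate, cx, Function.comp_def]
    ring

theorem countP_query_attemptGates (n : Fin T) (j : Fin d) (s : ℝ) :
    (attemptGates e n j s).countP (fun g => g.isQuery) = 4 ∧
    (attemptGates e n j s).countP (fun g => !g.isQuery) = 24 * width N + 2 := by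
  constructor
  · simp only [attemptGates, List.countP_append, (countP_query_tryMove e _ _ _ _ _).1,
      (countP_query_condSwap _ _ _ _ _ _).1]
  · simp only [attemptGates, List.countP_append, (countP_query_tryMove e _ _ _ _ _).2,
      (countP_query_condSwap _ _ _ _ _ _).2]
    ring

end AttemptCircuit

section Attempt

variable {N d T : ℕ} {a : Matrix (Fin N) (Fin N) ℝ} (B : BlackBox a d) [NeZero N]
variable {Q : Type} [DecidableEq Q] (e : Wire (width N) d T ≃ Q)

/-- The amplitude for leaving (`β = true`) or staying (`β = false`). -/
noncomputable def amp (s : ℝ) (β : Bool) (v : ℝ) : ℝ := if β then leaveAmp s v else stayAmp s v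

theorem exec_tryMove (addr : Fin (width N) ↪ Q) (hdisj : ∀ i q, addr i ≠ posEmb e q)
    (j : Fin d) (k : Fin T × Bool) (s : ℝ) (u : Fin N) (x fl rg) (hfl : fl k = false)
    (hrg : rg k = bits (0 : Fin N))
    (hu : ∀ p fl' g i, wires e x p fl' (Function.update rg k g) (addr i) = bits u i) :
    exec B (tryMove e addr hdisj j k s)
        (Finsupp.single (wires e x (fun _ => false) fl rg, fun _ => 0) 1)
      = ∑ β : Bool, (amp s β (slotRate B j u) : ℂ) • Finsupp.single (wires e x (fun _ => false)
          (Function.update fl k β)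
          (Function.update rg k (bits (if β then slotPos B j u else 0))), fun _ => 0) 1 := by
  have hu' : ∀ p fl' i, wires e x p fl' rg (addr i) = bits u i := by
    intro p fl' i
    simpa using hu p fl' (rg k) i
  rw [tryMove, exec_append, exec_append]
  simp only [exec_cons, exec_nil]
  rw [apply_query B e false addr hdisj u _ _ _ _ _ (hu' _ _), apply_rot B e _ _ _ _ _ _ _ _ hfl]
  simp only [map_sum, map_smul]
  refine Finset.sum_congr rfl fun β _ => ?_
  have hcopy : (fun i => xor (rg k i) (Function.update fl k β k &&
      xor false (bits (slotPos B j u) i))) = bits (if β then slotPos B j u else 0) := by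
    funext i
    rw [hrg, bits_zero, Function.update_self]
    cases β <;> simp [bits_zero]
  rw [exec_copySlot]
  dsimp only
  rw [hcopy, apply_query B e true addr hdisj u _ _ _ _ _ (hu _ _ _)]
  congr 2
  · simp [amp]
  · refine Prod.ext ?_ ?_
    · simp
    · simp

/-- The basis state with system content `u` and memory `f`, which lists the flag and the index
register for both moves of every attempt. -/
def conf (u : Fin N) (f : Fin T × Bool → Bool × Fin N) : Config Q (Fin d) :=
  (wires e (bits u) (fun _ => false) (fun k => (f k).1) (fun k => bits (f k).2), fun _ => 0)

/-- The register that the first move of an attempt at `u` prepares. -/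
def firstPos (j : Fin d) (u : Fin N) (β : Bool) : Fin N := if β then slotPos B j u else 0

/-- The position reached in the registers after the second move. -/
def lastPos (j : Fin d) (u : Fin N) (β β' : Bool) : Fin N :=
  if β' then slotPos B j (firstPos B j u β) else firstPos B j u β

/-- The position of the system after an attempt with outcomes `β` and `β'`. -/
def newPos (j : Fin d) (u : Fin N) (β β' : Bool) : Fin N := if β then lastPos B j u β β' else u

/-- The memory after an attempt. If the first flag is set, it contains the old position `u`. -/
def newMem (n : Fin T) (j : Fin d) (u : Fin N) (β β' : Bool) (f : Fin T × Bool → Bool × Fin N) :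
    Fin T × Bool → Bool × Fin N :=
  Function.update (Function.update f (n, false) (β, if β then u else lastPos B j u β β'))
    (n, true) (β', if β' then firstPos B j u β else 0)

theorem exec_attemptGates (n : Fin T) (j : Fin d) (s : ℝ) (u : Fin N)
    (f : Fin T × Bool → Bool × Fin N) (hf : ∀ b, f (n, b) = (false, 0)) :
    exec B (attemptGates e n j s) (Finsupp.single (conf e u f) 1)
      = ∑ β : Bool, ∑ β' : Bool, ((amp s β (slotRate B j u) *
          amp (s / 2) β' (slotRate B j (firstPos B j u β)) : ℝ) : ℂ) •
          Finsupp.single (conf e (newPos B j u β β') (newMem B n j u β β' f)) 1 := by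
  rw [attemptGates, exec_append, exec_append, exec_append, conf,
    exec_tryMove B e _ _ j (n, false) s u _ _ _ (by simp [hf]) (by simp [hf])
      (by simp [sysEmb_apply])]
  simp only [map_sum, map_smul]
  refine Finset.sum_congr rfl fun β _ => ?_
  rw [exec_tryMove B e _ _ j (n, true) (s / 2) (firstPos B j u β) _ _ _ (by simp [hf])
    (by simp [hf]) (by simp [regEmb_apply, firstPos])]
  simp only [map_sum, map_smul, Finset.smul_sum]
  refine Finset.sum_congr rfl fun β' _ => ?_
  rw [smul_smul, ← Complex.ofReal_mul, exec_condSwap, exec_condSwap]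
  congr 2
  dsimp only
  rw [extend_wires_reg, extend_wires_reg, extend_wires_reg, extend_wires_sys, conf]
  refine Prod.ext ?_ rfl
  dsimp only
  congr 1
  · funext i
    cases β <;> cases β' <;> simp [regEmb_apply, sysEmb_apply, newPos, lastPos, firstPos]
  · funext k
    obtain ⟨n', b⟩ := k
    by_cases hn : n' = n
    · subst hn
      cases b <;> simp [newMem]
    · simp [newMem, hn]
  · funext k
    obtain ⟨n', b⟩ := k
    by_cases hn : n' = n
    · subst hn
      cases b
      · cases β <;> cases β' <;> funext i <;>
          simp [regEmb_apply, sysEmb_apply, newMem, lastPos, firstPos]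
      · cases β <;> cases β' <;> funext i <;>
          simp [regEmb_apply, sysEmb_apply, newMem, lastPos, firstPos]
    · simp [newMem, hn]

end Attempt

/-! ### Tracing out the memory -/

section Channel

variable {N d : ℕ}

theorem reduced_sum_smul_left (A : Circuit N d) {ι : Type*} (t : Finset ι) (z : ι → ℂ)
    (ψ : ι → Config (Fin (width N) ⊕ Fin A.ancillas) (Fin A.registers) →₀ ℂ) (φ) :
    A.reduced (∑ i ∈ t, z i • ψ i) φ = ∑ i ∈ t, z i • A.reduced (ψ i) φ := by
  ext s s'
  have key : ∀ ψ, A.reduced ψ φ s s' = Finsupp.linearCombination ℂ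
      (fun c : Config (Fin (width N) ⊕ Fin A.ancillas) (Fin A.registers) =>
        if (fun i => c.1 (Sum.inl i)) = s then
          star (φ (Sum.elim s' fun i => c.1 (Sum.inr i), c.2)) else 0) ψ := by
    intro ψ
    rw [Finsupp.linearCombination_apply, Circuit.reduced]
    refine Finsupp.sum_congr fun c _ => ?_
    split_ifs <;> simp
  simp only [key, map_sum, map_smul, Matrix.sum_apply, Matrix.smul_apply]

theorem reduced_sum_smul_right (A : Circuit N d) {ι : Type*} (t : Finset ι) (z : ι → ℂ) (ψ)
    (φ : ι → Config (Fin (width N) ⊕ Fin A.ancillas) (Fin A.registers) →₀ ℂ) :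
    A.reduced ψ (∑ i ∈ t, z i • φ i) = ∑ i ∈ t, star (z i) • A.reduced ψ (φ i) := by
  ext s s'
  simp only [Matrix.sum_apply, Matrix.smul_apply, smul_eq_mul]
  simp only [Circuit.reduced, Finsupp.sum, Finset.mul_sum]
  rw [Finset.sum_comm]
  refine Finset.sum_congr rfl fun c _ => ?_
  split_ifs
  · rw [Finsupp.finsetSum_apply, star_sum, Finset.mul_sum]
    refine Finset.sum_congr rfl fun i _ => ?_
    rw [Finsupp.smul_apply, smul_eq_mul, star_mul']
    ring
  · simp

/-- The labelling of the qubits of a circuit by their role in a sequence of `T` jump attempts. -/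
def wireEquiv {w d T m : ℕ} (e : Ancilla w d T ≃ Fin m) : Wire w d T ≃ Fin w ⊕ Fin m :=
  Equiv.sumCongr (Equiv.refl _) e

variable {T m : ℕ}

/-- The partial trace over the ancillas of a sequence of `T` jump attempts. -/
def ancillaTrace (ψ φ : Config (Fin (width N) ⊕ Fin m)
    (Fin d) →₀ ℂ) : Matrix (Fin (width N) → Bool) (Fin (width N) → Bool) ℂ :=
  Circuit.reduced (N := N) (d := d) ⟨m, d, []⟩ ψ φ

theorem ancillaTrace_sum_smul_left {ι : Type*} (t : Finset ι) (z : ι → ℂ)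
    (ψ : ι → Config (Fin (width N) ⊕ Fin m) (Fin d) →₀ ℂ)
    (φ) : ancillaTrace (∑ i ∈ t, z i • ψ i) φ = ∑ i ∈ t, z i • ancillaTrace (ψ i) φ :=
  reduced_sum_smul_left ⟨m, d, []⟩ t z ψ φ

theorem ancillaTrace_sum_smul_right {ι : Type*} (t : Finset ι) (z : ι → ℂ) (ψ)
    (φ : ι → Config (Fin (width N) ⊕ Fin m) (Fin d) →₀ ℂ) :
    ancillaTrace ψ (∑ i ∈ t, z i • φ i) = ∑ i ∈ t, star (z i) • ancillaTrace ψ (φ i) :=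
  reduced_sum_smul_right ⟨m, d, []⟩ t z ψ φ

variable (e : Ancilla (width N) d T ≃ Fin m)

theorem conf_wireEquiv_sys (u : Fin N) (f : Fin T × Bool → Bool × Fin N) (i : Fin (width N)) :
    (conf (wireEquiv e) u f).1 (Sum.inl i) = bits u i :=
  wires_sys (wireEquiv e) (bits u) (fun _ => false) (fun k => (f k).1) (fun k => bits (f k).2) i

theorem conf_wireEquiv_eq_iff (u u' : Fin N) (f f' : Fin T × Bool → Bool × Fin N)
    (x' : Fin (width N) → Bool) :
    conf (wireEquiv e) u' f' = (Sum.elim x' fun i =>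
      (conf (wireEquiv e) u f).1 (Sum.inr i),
        (conf (wireEquiv e) u f).2) ↔ bits u' = x' ∧ f = f' := by
  constructor
  · intro h
    have h1 := congrArg Prod.fst h
    constructor
    · funext i
      have := congrFun h1 (Sum.inl i)
      rwa [conf_wireEquiv_sys] at this
    · have h2 : ∀ y : Ancilla (width N) d T,
          (conf (wireEquiv e) u' f').1 (wireEquiv e (.inr y))
            = (conf (wireEquiv e) u f).1 (wireEquiv e (.inr y)) :=
        fun y => congrFun h1 (Sum.inr (e y))
      funext k
      refine Prod.ext ?_ ?_
      · have := h2 (.inr (.inl k))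
        simp only [conf, wires_flag] at this
        exact this.symm
      · apply bits_injective
        funext i
        have := h2 (.inr (.inr (k, i)))
        simp only [conf, wires_reg] at this
        exact this.symm
  · rintro ⟨rfl, rfl⟩
    refine Prod.ext ?_ rfl
    funext q
    rcases q with i | q
    · exact conf_wireEquiv_sys e u' f i
    · obtain ⟨y, rfl⟩ := e.surjective q
      change (conf (wireEquiv e) u' f).1 (wireEquiv e (.inr y))
            = (conf (wireEquiv e) u f).1 (wireEquiv e (.inr y))
      rcases y with y | y | y <;> simp [conf]

/-- Basis states with different memories are decohered by the partial trace. -/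
theorem ancillaTrace_conf (u u' : Fin N) (f f' : Fin T × Bool → Bool × Fin N) :
    ancillaTrace (Finsupp.single (conf (wireEquiv e) u f) 1)
        (Finsupp.single (conf (wireEquiv e) u' f') 1)
      = if f = f' then Matrix.single (bits u) (bits u') 1 else 0 := by
  ext x x'
  rw [ancillaTrace, Circuit.reduced, Finsupp.sum_single_index (by simp), Finsupp.single_apply]
  have h1 : (fun i => (conf (wireEquiv e) u f).1 (Sum.inl i)) = bits u :=
    funext (conf_wireEquiv_sys e u f)
  rw [h1, apply_ite (fun M : Matrix (Fin (width N) → Bool) (Fin (width N) → Bool) ℂ => M x x'),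
    Matrix.single_apply]
  have h2 := conf_wireEquiv_eq_iff e u u' f f' x'
  simp only [h2]
  by_cases hf : f = f' <;> by_cases hx : bits u = x <;> by_cases hx' : bits u' = x' <;>
    simp [hf, hx, hx']

variable [NeZero N] {a : Matrix (Fin N) (Fin N) ℝ} (B : BlackBox a d)

theorem amp_true_sq (s v : ℝ) : amp s true v ^ 2 = 1 - amp s false v ^ 2 := by
  have := stayAmp_sq_add_leaveAmp_sq s v
  simp only [amp, if_true, Bool.false_eq_true, if_false]
  linarith

theorem amp_false_sq {s v : ℝ} (hs : 0 ≤ s) (hv : 0 ≤ v) :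
    amp s false v ^ 2 = Real.exp (-(2 * v * s)) := by
  simp only [amp, Bool.false_eq_true, if_false, stayAmp]
  rw [abs_of_nonneg hs, abs_of_nonneg hv, ← Real.exp_nat_mul]
  congr 1
  push_cast
  ring

/-- The squared amplitudes of a jump attempt are the transition probabilities. -/
theorem attempt_mul_apply (j : Fin d) {s : ℝ} (hs : 0 ≤ s) (h0 : ∀ u, 0 ≤ slotRate B j u)
    (M : Matrix (Fin N) (Fin N) ℝ) (u v : Fin N) :
    (attempt (fun x => 2 * slotRate B j x * s) (slotPos B j) * M) u v
      = ∑ β : Bool, ∑ β' : Bool, (amp s β (slotRate B j u) *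
          amp (s / 2) β' (slotRate B j (firstPos B j u β))) ^ 2 * M (newPos B j u β β') v := by
  have h1 : ∀ x, 2 * slotRate B j x * s / 2 = 2 * slotRate B j x * (s / 2) := fun x => by ring
  rw [attempt, Matrix.add_mul, Matrix.sub_mul, Matrix.one_mul]
  simp only [Matrix.mul_assoc]
  rw [Matrix.add_apply, Matrix.sub_apply, Matrix.diagonal_mul, Matrix.diagonal_mul,
    jumpMatrix_mul_apply, Matrix.add_mul, Matrix.sub_mul, Matrix.one_mul, Matrix.mul_assoc,
    Matrix.add_apply, Matrix.sub_apply, Matrix.diagonal_mul, Matrix.diagonal_mul,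
    jumpMatrix_mul_apply]
  simp only [Fintype.sum_bool, mul_pow, amp_true_sq, newPos, firstPos, lastPos, if_true,
    Bool.false_eq_true, if_false, h1, amp_false_sq hs (h0 _),
    amp_false_sq (show 0 ≤ s / 2 by positivity) (h0 _)]
  ring

/-- The memory records the outcomes of both moves and, if the first flag is set, the old position.
If it is not set, the memory does not depend on the position. -/
theorem newMem_eq_iff (n : Fin T) (j : Fin d) (u u' : Fin N) (β β' γ γ' : Bool)
    (f f' : Fin T × Bool → Bool × Fin N) (hf : ∀ b, f (n, b) = (false, 0))
    (hf' : ∀ b, f' (n, b) = (false, 0)) :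
    newMem B n j u β β' f = newMem B n j u' γ γ' f'
      ↔ f = f' ∧ β = γ ∧ β' = γ' ∧ (β = true → u = u') := by
  constructor
  · intro h
    have h0 := congrFun h (n, false)
    have h1 := congrFun h (n, true)
    simp only [newMem, ne_eq, Prod.mk.injEq, Bool.false_eq_true, and_false, not_false_eq_true,
      Function.update_of_ne, Function.update_self] at h0 h1
    refine ⟨?_, h0.1, h1.1, ?_⟩
    · funext k
      obtain ⟨n', b⟩ := k
      by_cases hn : n' = n
      · subst hn
        rw [hf, hf']
      · simpa [newMem, hn] using congrFun h (n', b)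
    · intro hβ
      have h2 := h0.2
      rw [← h0.1, hβ] at h2
      simpa using h2
  · rintro ⟨rfl, rfl, rfl, h⟩
    cases β
    · simp [newMem, lastPos, firstPos]
    · rw [h rfl]

theorem newMem_of_ne {n n' : Fin T} (h : n' ≠ n) (j : Fin d) (u : Fin N) (β β' b : Bool)
    (f : Fin T × Bool → Bool × Fin N) : newMem B n j u β β' f (n', b) = f (n', b) := by
  simp [newMem, h]

/-- The gates of the attempts in a list. -/
noncomputable def attemptsGates (slot : Fin T → Fin d) (s : ℝ) (l : List (Fin T)) :
    List (Gate N d (Fin (width N) ⊕ Fin m) (Fin d)) :=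
  l.flatMap fun n => attemptGates (wireEquiv e) n (slot n) s

/-- A sequence of jump attempts maps the coherence between different basis states to a multiple of
itself, and it moves the populations by the product of the transition matrices. -/
theorem ancillaTrace_exec_attemptsGates (slot : Fin T → Fin d) {s : ℝ} (hs : 0 ≤ s)
    (h0 : ∀ j u, 0 ≤ slotRate B j u) (l : List (Fin T)) (hl : l.Nodup) (u u' : Fin N)
    (f f' : Fin T × Bool → Bool × Fin N) (hf : ∀ n ∈ l, ∀ b, f (n, b) = (false, 0))
    (hf' : ∀ n ∈ l, ∀ b, f' (n, b) = (false, 0)) :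
    ancillaTrace
        (exec B (attemptsGates e slot s l)
          (Finsupp.single (conf (wireEquiv e) u f) 1))
        (exec B (attemptsGates e slot s l)
          (Finsupp.single (conf (wireEquiv e) u' f') 1))
      = if f = f' then
          if u = u' then
            ∑ v, (((l.map fun n => attempt (fun x => 2 * slotRate B (slot n) x * s)
              (slotPos B (slot n))).prod u v : ℝ) : ℂ) • Matrix.single (bits v) (bits v) 1
          else (((l.map fun n => stayAmp s (slotRate B (slot n) u) *
              stayAmp s (slotRate B (slot n) u')).prod : ℝ) : ℂ) •
            Matrix.single (bits u) (bits u') 1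
        else 0 := by
  induction l generalizing u u' f f' with
  | nil =>
    rw [attemptsGates, List.flatMap_nil, exec_nil, exec_nil, ancillaTrace_conf]
    by_cases hff : f = f'
    · rw [if_pos hff, if_pos hff]
      by_cases huu : u = u'
      · subst huu
        rw [if_pos rfl, Finset.sum_eq_single u]
        · simp
        · intro b _ hb
          simp [Ne.symm hb]
        · simp
      · simp [huu]
    · rw [if_neg hff, if_neg hff]
  | cons n l ih =>
    rw [List.nodup_cons] at hl
    have hn := hf n (by simp)
    have hn' := hf' n (by simp)
    have hmem : ∀ (f : Fin T × Bool → Bool × Fin N) (u : Fin N) (β β' : Bool),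
        (∀ n' ∈ n :: l, ∀ b, f (n', b) = (false, 0)) →
        ∀ n' ∈ l, ∀ b, newMem B n (slot n) u β β' f (n', b) = (false, 0) := by
      intro f u β β' hf n' hl' b
      have hne : n' ≠ n := fun h => hl.1 (h ▸ hl')
      rw [newMem_of_ne B hne]
      exact hf n' (by simp [hl']) b
    have e1 : attemptsGates e slot s (n :: l)
        = attemptGates (wireEquiv e) n (slot n) s ++ attemptsGates e slot s l := by
      rw [attemptsGates, List.flatMap_cons, attemptsGates]
    rw [e1, exec_append, exec_append, exec_attemptGates B _ n (slot n) s u f hn,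
      exec_attemptGates B _ n (slot n) s u' f' hn']
    simp only [← Fintype.sum_prod_type']
    simp only [map_sum, map_smul]
    rw [ancillaTrace_sum_smul_left]
    simp only [ancillaTrace_sum_smul_right, ih hl.2 _ _ _ _ (hmem f u _ _ hf)
      (hmem f' u' _ _ hf'), newMem_eq_iff B n (slot n) _ _ _ _ _ _ f f' hn hn']
    by_cases hff : f = f'
    · subst hff
      by_cases huu : u = u'
      · subst huu
        simp only [if_true]
        have hR : ∀ v, (((n :: l).map fun n => attempt (fun x => 2 * slotRate B (slot n) x * s)
            (slotPos B (slot n))).prod u v) = ∑ q : Bool × Bool,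
              (amp s q.1 (slotRate B (slot n) u) *
              amp (s / 2) q.2 (slotRate B (slot n) (firstPos B (slot n) u q.1))) ^ 2 *
              (l.map fun n => attempt (fun x => 2 * slotRate B (slot n) x * s)
            (slotPos B (slot n))).prod (newPos B (slot n) u q.1 q.2) v := by
          intro v
          rw [List.map_cons, List.prod_cons, attempt_mul_apply B (slot n) hs (h0 _),
            Fintype.sum_prod_type]
        simp only [hR, Complex.ofReal_sum, Finset.sum_smul]
        rw [Finset.sum_comm]
        refine Finset.sum_congr rfl fun q _ => ?_
        rw [Finset.sum_eq_single q]
        · simp only [implies_true, and_self, if_true, Finset.smul_sum, smul_smul]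
          refine Finset.sum_congr rfl fun v _ => ?_
          congr 1
          simp
          ring
        · intro q' _ hq'
          rw [if_neg, smul_zero]
          rintro ⟨-, h1, h2, -⟩
          exact hq' (Prod.ext h1.symm h2.symm)
        · simp
      · have key : ∀ z, stayAmp (s / 2) z ^ 2 = 1 - leaveAmp (s / 2) z ^ 2 := fun z => by
          have := stayAmp_sq_add_leaveAmp_sq (s / 2) z
          linarith
        -- Only the histories without a first move survive. Their second move starts at `0` for both
        -- basis states, so that the weights of its outcomes add up to one.
        simp only [Fintype.sum_prod_type, Fintype.sum_bool, newPos, firstPos, amp, huu]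
        simp only [reduceCtorEq, and_false, and_true, if_false, if_true, smul_zero,
          add_zero, zero_add, imp_false, not_true_eq_false, not_false_eq_true, Bool.false_eq_true,
          huu, smul_smul, ← add_smul, List.map_cons, List.prod_cons]
        congr 1
        simp only [Complex.star_def, Complex.conj_ofReal]
        norm_cast
        linear_combination (stayAmp s (slotRate B (slot n) u) *
          stayAmp s (slotRate B (slot n) u') * (l.map fun n => stayAmp s (slotRate B (slot n) u) *
              stayAmp s (slotRate B (slot n) u')).prod) * key (slotRate B (slot n) 0)
    · simp [hff]

end Channel

/-! ### The complete circuit and its error -/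

section JumpCircuit

variable {N d : ℕ}

/-- The circuit that carries out jump attempts for the given slots, one after the other. -/
noncomputable def jumpCircuit (slots : List (Fin d)) (s : ℝ) : Circuit N d where
  ancillas := Fintype.card (Ancilla (width N) d slots.length)
  registers := d
  gates := attemptsGates (Fintype.equivFin _) slots.get s (List.finRange slots.length)

theorem countP_attemptsGates {T m : ℕ} (e : Ancilla (width N) d T ≃ Fin m) (slot : Fin T → Fin d)
    (s : ℝ) (l : List (Fin T)) :
    (attemptsGates (N := N) e slot s l).countP (fun g => g.isQuery) = 4 * l.length ∧
    (attemptsGates (N := N) e slot s l).countP (fun g => !g.isQuery)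
      = (24 * width N + 2) * l.length := by
  induction l with
  | nil => simp [attemptsGates]
  | cons n l ih =>
    have h := countP_query_attemptGates (N := N) (wireEquiv e) n (slot n) s
    constructor
    · rw [attemptsGates, List.flatMap_cons, List.countP_append, h.1, ← attemptsGates, ih.1,
        List.length_cons]
      ring
    · rw [attemptsGates, List.flatMap_cons, List.countP_append, h.2, ← attemptsGates, ih.2,
        List.length_cons]
      ring

theorem queryCount_jumpCircuit (slots : List (Fin d)) (s : ℝ) :
    (jumpCircuit slots s : Circuit N d).queryCount = 4 * slots.length :=
  ((countP_attemptsGates _ _ _ _).1).trans (by rw [List.length_finRange])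

theorem gateCount_jumpCircuit (slots : List (Fin d)) (s : ℝ) :
    (jumpCircuit slots s : Circuit N d).gateCount = (24 * width N + 2) * slots.length :=
  ((countP_attemptsGates _ _ _ _).2).trans (by rw [List.length_finRange])

theorem channel_single {a : Matrix (Fin N) (Fin N) ℝ} (B : BlackBox a d) (A : Circuit N d)
    (x y : Fin N) :
    A.channel B (Matrix.single x y 1) = A.reduced (A.run B x) (A.run B y) := by
  change (∑ x', ∑ y', (Matrix.single x y (1 : ℂ)) x' y' • A.reduced (A.run B x') (A.run B y')) = _
  rw [Finset.sum_eq_single x, Finset.sum_eq_single y]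
  · simp
  · intro y' _ hy
    simp [Ne.symm hy]
  · simp
  · intro x' _ hx
    simp [Ne.symm hx]
  · simp

theorem encode_single (x y : Fin N) :
    encode N (Matrix.single x y 1) = Matrix.single (bits x) (bits y) 1 := by
  ext i j
  change (encodeMatrix N * Matrix.single x y (1 : ℂ) * (encodeMatrix N)ᴴ) i j = _
  rw [Matrix.mul_apply, Finset.sum_eq_single y]
  · rw [Matrix.mul_single_apply_same, Matrix.conjTranspose_apply]
    simp only [encodeMatrix, Matrix.single_apply, mul_one, eq_comm (a := i), eq_comm (a := j)]
    by_cases h1 : bits x = i <;> by_cases h2 : bits y = j <;>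
      simp [h1, h2]
  · intro y' _ hy
    rw [Matrix.mul_single_apply_of_ne _ _ _ _ _ hy, zero_mul]
  · simp

theorem map_get_finRange {α β : Type*} (l : List α) (f : α → β) :
    ((List.finRange l.length).map fun n => f (l.get n)) = l.map f := by
  conv_rhs => rw [← List.map_get_finRange l, List.map_map]
  rfl

variable [NeZero N] {a : Matrix (Fin N) (Fin N) ℝ} (B : BlackBox a d)

theorem conf_wireEquiv_initial {T m : ℕ} (e : Ancilla (width N) d T ≃ Fin m) (x : Fin N) :
    (conf (wireEquiv e) x fun _ => (false, 0))
      = ((Sum.elim (bits x) fun _ => false, fun _ => 0) :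
        Config (Fin (width N) ⊕ Fin m) (Fin d)) := by
  refine Prod.ext ?_ rfl
  funext q
  rcases q with i | q
  · exact conf_wireEquiv_sys e x _ i
  · obtain ⟨y, rfl⟩ := e.surjective q
    change (conf (wireEquiv e) x _).1 (wireEquiv e (.inr y)) = false
    rcases y with y | y | y <;> simp [conf, bits_zero]

theorem reduced_run_jumpCircuit (slots : List (Fin d)) {s : ℝ} (hs : 0 ≤ s)
    (h0 : ∀ j u, 0 ≤ slotRate B j u) (x y : Fin N) :
    (jumpCircuit slots s).reduced ((jumpCircuit slots s).run B x) ((jumpCircuit slots s).run B y)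
      = if x = y then
          ∑ v, (((slots.map fun j => attempt (fun x => 2 * slotRate B j x * s)
            (slotPos B j)).prod x v : ℝ) : ℂ) • Matrix.single (bits v) (bits v) 1
        else (((slots.map fun j => stayAmp s (slotRate B j x) *
            stayAmp s (slotRate B j y)).prod : ℝ) : ℂ) • Matrix.single (bits x) (bits y) 1 := by
  have key := ancillaTrace_exec_attemptsGates
    (Fintype.equivFin (Ancilla (width N) d slots.length)) B slots.get hs h0
    (List.finRange slots.length) (List.nodup_finRange _) x y (fun _ => (false, 0))
    (fun _ => (false, 0)) (fun _ _ _ => rfl) (fun _ _ _ => rfl)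
  rw [if_pos rfl, map_get_finRange slots fun j => attempt (fun x => 2 * slotRate B j x * s)
    (slotPos B j), map_get_finRange slots fun j => stayAmp s (slotRate B j x) *
            stayAmp s (slotRate B j y), conf_wireEquiv_initial, conf_wireEquiv_initial] at key
  rw [← key, Circuit.run, Circuit.run, foldl_apply_eq_exec, foldl_apply_eq_exec]
  rfl

/-- If the jump attempts reproduce the decay of all coherences exactly, then the error of the
circuit is that of the classical Markov chain of the populations. -/
theorem diamondNorm_channel_jumpCircuit_sub_le (slots : List (Fin d)) {s t η : ℝ} (hs : 0 ≤ s)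
    (hη : 0 ≤ η) (h0 : ∀ j u, 0 ≤ slotRate B j u)
    (hcoh : ∀ x y, x ≠ y → (slots.map fun j => stayAmp s (slotRate B j x) *
      stayAmp s (slotRate B j y)).prod = Real.exp (-((∑ k, a k x) + ∑ k, a k y) * t))
    (hpop : ∀ x, ∑ v, |((slots.map fun j => attempt (fun x => 2 * slotRate B j x * s)
      (slotPos B j)).prod - NormedSpace.exp (t • generator a)) x v| ≤ η) :
    diamondNorm ((jumpCircuit slots s).channel B - encode N ∘ₗ evolution (lindbladian a) t)
      ≤ η := by
  refine diamondNorm_le_of_classical _ _ bits hη hpop fun ρ => ?_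
  have hsingle : ∀ x y, ((jumpCircuit slots s).channel B -
      encode N ∘ₗ evolution (lindbladian a) t) (Matrix.single x y 1)
      = if x = y then ∑ v, ((((slots.map fun j => attempt (fun x => 2 * slotRate B j x * s)
        (slotPos B j)).prod - NormedSpace.exp (t • generator a)) x v : ℝ) : ℂ) •
          Matrix.single (bits v) (bits v) 1 else 0 := by
    intro x y
    rw [LinearMap.sub_apply, LinearMap.comp_apply, channel_single,
      reduced_run_jumpCircuit B slots hs h0]
    by_cases h : x = y
    · subst h
      rw [if_pos rfl, if_pos rfl, evolution_lindbladian_single_same, map_sum,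
        ← Finset.sum_sub_distrib]
      refine Finset.sum_congr rfl fun v _ => ?_
      rw [map_smul, encode_single, ← sub_smul, Matrix.sub_apply, Complex.ofReal_sub]
    · rw [if_neg h, if_neg h, evolution_lindbladian_single_of_ne a t h, map_smul, encode_single,
        hcoh x y h, sub_self]
  conv_lhs => rw [Matrix.matrix_eq_sum_single ρ]
  simp only [map_sum]
  refine Finset.sum_congr rfl fun x _ => ?_
  rw [Finset.sum_eq_single x]
  · rw [← mul_one (ρ x x), ← smul_eq_mul, ← Matrix.smul_single, map_smul, hsingle, if_pos rfl,
      Finset.smul_sum]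
    simp only [smul_smul, smul_eq_mul, mul_one]
  · intro y _ hy
    rw [← mul_one (ρ x y), ← smul_eq_mul, ← Matrix.smul_single, map_smul, hsingle,
      if_neg (Ne.symm hy), smul_zero]
  · simp

end JumpCircuit

section Slots

variable {N d : ℕ} {a : Matrix (Fin N) (Fin N) ℝ} (B : BlackBox a d)

theorem slotRate_nonneg (ha : ∀ k l, 0 ≤ a k l) (j : Fin d) (x : Fin N) : 0 ≤ slotRate B j x := by
  rw [slotRate]
  rcases B.col x j with _ | k
  · exact le_rfl
  · exact ha k x

/-- The rate of leaving a basis state is at most the diamond norm, as it is part of the decay rate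
of the coherences with another basis state. -/
theorem sum_le_diamondNorm_lindbladian (ha : ∀ k l, 0 ≤ a k l) (hN : 2 ≤ N) (x : Fin N) :
    ∑ k, a k x ≤ diamondNorm (lindbladian a) := by
  have : Nontrivial (Fin N) := Fin.nontrivial_iff_two_le.mpr hN
  obtain ⟨y, hy⟩ := exists_ne x
  have h := norm_apply_single_le_diamondNorm (lindbladian a) x y x y
  rw [lindbladian_single_of_ne a hy.symm, Matrix.smul_apply, Matrix.single_apply_same, smul_eq_mul,
    mul_one, Complex.norm_real, norm_neg] at h
  have hy0 : 0 ≤ ∑ k, a k y := Finset.sum_nonneg fun k _ => ha k y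
  linarith [le_abs_self ((∑ k, a k x) + ∑ k, a k y), Real.norm_eq_abs ((∑ k, a k x) + ∑ k, a k y)]

variable [NeZero N]

theorem sum_slotRate_mul_ite (x s : Fin N) :
    ∑ j, slotRate B j x * (if s = slotPos B j x then 1 else 0) = a s x := by
  obtain ⟨h1, h2⟩ := B.col_lists x
  by_cases h : a s x = 0
  · rw [h]
    refine Finset.sum_eq_zero fun j _ => ?_
    rw [slotRate, slotPos]
    rcases B.col x j with _ | k
    · simp
    · by_cases hk : s = k
      · subst hk
        simp [h]
      · simp [hk]
  · obtain ⟨j, hj, huniq⟩ := h2 s h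
    dsimp only at hj huniq
    rw [Finset.sum_eq_single j]
    · simp [slotRate, slotPos, hj]
    · intro j' _ hj'
      rw [slotRate, slotPos]
      rcases hc : B.col x j' with _ | k
      · simp
      · by_cases hk : s = k
        · exact absurd (huniq j' (hk ▸ hc)) hj'
        · simp [hk]
    · simp

theorem sum_slotRate (x : Fin N) : ∑ j, slotRate B j x = ∑ k, a k x := by
  simp only [← sum_slotRate_mul_ite B x]
  rw [Finset.sum_comm]
  refine Finset.sum_congr rfl fun j _ => ?_
  rw [← Finset.mul_sum, Finset.sum_ite_eq' Finset.univ (slotPos B j x)]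
  simp

theorem slotRate_le_sum (ha : ∀ k l, 0 ≤ a k l) (j : Fin d) (x : Fin N) :
    slotRate B j x ≤ ∑ k, a k x := by
  rw [← sum_slotRate B x]
  exact Finset.single_le_sum (fun j _ => slotRate_nonneg B ha j x) (Finset.mem_univ j)

/-- The generator is the sum over the slots of the generators of the single jumps. -/
theorem sum_jump_generators (s : ℝ) :
    ((List.finRange d).map fun j => Matrix.diagonal (fun x => 2 * slotRate B j x * s) *
      (jumpMatrix (slotPos B j) - 1)).sum = s • generator a := by
  rw [← Fin.sum_univ_def]
  ext x v
  rw [Matrix.sum_apply, Matrix.smul_apply, generator, Matrix.of_apply, smul_eq_mul,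
    ← sum_slotRate B x, ← sum_slotRate_mul_ite B x v]
  have h : (if x = v then ∑ j, slotRate B j x else 0)
      = ∑ j, slotRate B j x * (if x = v then 1 else 0) := by split_ifs <;> simp
  rw [h, ← Finset.sum_sub_distrib, Finset.mul_sum, Finset.mul_sum]
  refine Finset.sum_congr rfl fun j _ => ?_
  rw [Matrix.diagonal_mul, Matrix.sub_apply, Matrix.one_apply, jumpMatrix, Matrix.of_apply]
  ring

theorem prod_stayAmp {s : ℝ} (hs : 0 ≤ s) (ha : ∀ k l, 0 ≤ a k l) (x y : Fin N) :
    ((List.finRange d).map fun j => stayAmp s (slotRate B j x) * stayAmp s (slotRate B j y)).prod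
      = Real.exp (-((∑ k, a k x) + ∑ k, a k y) * s) := by
  rw [← Fin.prod_univ_def]
  have h : ∀ j, stayAmp s (slotRate B j x) * stayAmp s (slotRate B j y)
      = Real.exp (-(slotRate B j x + slotRate B j y) * s) := by
    intro j
    rw [stayAmp, stayAmp, abs_of_nonneg hs, abs_of_nonneg (slotRate_nonneg B ha j x),
      abs_of_nonneg (slotRate_nonneg B ha j y), ← Real.exp_add]
    congr 1
    ring
  simp only [h]
  rw [← Real.exp_sum, ← Finset.sum_mul, Finset.sum_neg_distrib, Finset.sum_add_distrib,
    sum_slotRate, sum_slotRate]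

end Slots

section Sweeps

variable {N d : ℕ}

/-- The slots in the order in which they are used: `r` sweeps, each running through all the slots
forwards and then backwards. -/
def sweeps (d r : ℕ) : List (Fin d) :=
  (List.replicate r (List.finRange d ++ (List.finRange d).reverse)).flatten

theorem length_sweeps (d r : ℕ) : (sweeps d r).length = r * (2 * d) := by
  simp [sweeps, two_mul]

theorem prod_map_sweeps {M : Type*} [Monoid M] (d r : ℕ) (f : Fin d → M) :
    ((sweeps d r).map f).prod
      = ((List.finRange d ++ (List.finRange d).reverse).map f).prod ^ r := by
  rw [sweeps, List.map_flatten, List.map_replicate, List.prod_flatten, List.map_replicate,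
    List.prod_replicate]

open scoped Matrix.Norms.Operator in
/-- The simulation error of `r` sweeps in time `t`. -/
theorem diamondNorm_channel_sweeps_sub_le [NeZero N] {a : Matrix (Fin N) (Fin N) ℝ}
    (B : BlackBox a d) (ha : ∀ k l, 0 ≤ a k l) (hN : 2 ≤ N) {t τ : ℝ} (ht : 0 ≤ t)
    (hτ : diamondNorm (lindbladian a) * t ≤ τ) {r : ℕ} (hr : r ≠ 0) :
    diamondNorm ((jumpCircuit (sweeps d r) (t / (2 * r))).channel B -
        encode N ∘ₗ evolution (lindbladian a) t)
      ≤ min 2 (r * (2 * expTail (2 * d * (2 * (τ / r))))) := by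
  have hr0 : (0 : ℝ) < r := by positivity
  have hs : 0 ≤ t / (2 * r) := by positivity
  have hrate : ∀ x, (∑ k, a k x) * t ≤ τ := fun x =>
    (mul_le_mul_of_nonneg_right (sum_le_diamondNorm_lindbladian ha hN x) ht).trans hτ
  have hτ0 : 0 ≤ τ :=
    (mul_nonneg (Finset.sum_nonneg fun k _ => ha k 0) ht).trans (hrate 0)
  have h0 := slotRate_nonneg B ha
  have hy0 : ∀ j x, 0 ≤ 2 * slotRate B j x * (t / (2 * r)) := fun j x => by
    have := h0 j x
    positivity
  have hyh : ∀ j x, 2 * slotRate B j x * (t / (2 * r)) ≤ τ / r := fun j x => by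
    have h1 : 2 * slotRate B j x * (t / (2 * r)) = slotRate B j x * t / r := by
      field_simp
    rw [h1]
    gcongr
    exact (mul_le_mul_of_nonneg_right (slotRate_le_sum B ha j x) ht).trans (hrate x)
  have hsum := sum_jump_generators B (t / (2 * r))
  have hgen : (2 * r : ℝ) • (t / (2 * r)) • generator a = t • generator a := by
    rw [smul_smul]
    congr 1
    field_simp
  have herr := norm_palindrome_attempt_pow_sub_exp_le (List.finRange d)
    (fun j x => 2 * slotRate B j x * (t / (2 * r))) (slotPos B) hy0 hyh (by positivity) r
  have hexp := norm_exp_generator_le (List.finRange d)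
    (fun j x => 2 * slotRate B j x * (t / (2 * r))) (slotPos B) hy0 hyh (2 * r) (by positivity)
    (by positivity)
  rw [hsum, hgen, List.length_finRange, ← prod_map_sweeps] at herr
  rw [hsum, hgen] at hexp
  have hprod : ‖((sweeps d r).map fun j => attempt (fun x => 2 * slotRate B j x * (t / (2 * r)))
      (slotPos B j)).prod‖ ≤ 1 :=
    norm_prod_attempt_le _ _ _ hy0
  have htwo := (norm_sub_le _ _).trans (add_le_add hprod hexp)
  refine diamondNorm_channel_jumpCircuit_sub_le B _ hs ?_ h0 ?_ fun x =>
    (sum_abs_row_le_norm _ x).trans (le_min (htwo.trans (by norm_num)) herr)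
  · exact le_min (by norm_num) ((norm_nonneg _).trans herr)
  · intro x y _
    rw [prod_map_sweeps, List.map_append, List.prod_append, List.map_reverse,
      (List.reverse_perm _).prod_eq, prod_stayAmp B hs ha, ← Real.exp_add, ← Real.exp_nat_mul]
    congr 1
    field_simp
    ring

end Sweeps

/-! ### Resources -/

section Budget

/-- The number of sweeps that suffices for precision `ε` in rescaled time `τ`. It is positive, also
for `d = 0` or `τ = 0`. -/
noncomputable def sweepCount (d : ℕ) (τ ε : ℝ) : ℕ :=
  ⌈16 * (d : ℝ) ^ 2 * τ ^ (3 / 2 : ℝ) / √ε⌉₊ + 1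

/-- The error is at most `256 / 9 * d ^ 3 * u ^ 6 / r ^ 2`, once `4 * d * u ^ 2 / r`, which bounds
the norm of the generator of one sweep, is at most `1`. Both estimates follow from the lower bound
on `r`. -/
theorem sweep_error_lt {d r : ℕ} {u e : ℝ} (hu : 0 ≤ u) (he : 0 < e) (he3 : e ^ 2 < 3)
    (hr1 : 1 ≤ r) (hr : 16 * (d : ℝ) ^ 2 * u ^ 3 < r * e) :
    r * (2 * expTail (2 * d * (2 * (u ^ 2 / r)))) < e ^ 2 := by
  have hr1' : (1 : ℝ) ≤ r := by exact_mod_cast hr1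
  have hr0 : (0 : ℝ) < r := by linarith
  rcases Nat.eq_zero_or_pos d with rfl | hd
  · have : expTail 0 = 0 := by simp [expTail]
    simp only [Nat.cast_zero, mul_zero, zero_mul, this]
    positivity
  have hd1 : (1 : ℝ) ≤ d := by exact_mod_cast hd
  have e1 : 2 * (d : ℝ) * (2 * (u ^ 2 / r)) = 4 * d * u ^ 2 / r := by ring
  have hc : 4 * d * u ^ 2 / r ≤ 1 := by
    rw [div_le_one hr0]
    by_contra! h
    have hu0 : 0 < u := by
      rcases hu.eq_or_lt with h0 | h0
      · subst h0
        simp at h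
        linarith
      · exact h0
    have h1 : 4 * d * u < e := by
      have h2 : (4 * d * u ^ 2) * (4 * d * u) < (4 * d * u ^ 2) * e := by
        calc (4 * d * u ^ 2) * (4 * d * u) = 16 * (d : ℝ) ^ 2 * u ^ 3 := by ring
          _ < r * e := hr
          _ ≤ (4 * d * u ^ 2) * e := by gcongr
      exact lt_of_mul_lt_mul_left h2 (by positivity)
    have h2 : (4 * d * u) ^ 2 < e ^ 2 := by gcongr
    have h3 : (d : ℝ) * u ^ 2 ≤ d ^ 2 * u ^ 2 := by
      gcongr
      nlinarith
    nlinarith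
  rw [e1]
  refine lt_of_le_of_lt (mul_le_mul_of_nonneg_left (mul_le_mul_of_nonneg_left
    (expTail_le (by positivity) hc) (by norm_num)) hr0.le) ?_
  have h1 : (16 * (d : ℝ) ^ 2 * u ^ 3) ^ 2 < (r * e) ^ 2 := by gcongr
  have h2 : (d : ℝ) ^ 3 * u ^ 6 ≤ d ^ 4 * u ^ 6 := by
    gcongr
    norm_num
  have h3 : (r : ℝ) * (2 * (2 / 9 * (4 * d * u ^ 2 / r) ^ 3))
      = 256 / 9 * (d ^ 3 * u ^ 6) / r ^ 2 := by
    field_simp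
    ring
  rw [h3, div_lt_iff₀ (by positivity)]
  have h4 : 0 ≤ (d : ℝ) ^ 4 * u ^ 6 := by positivity
  nlinarith

theorem min_two_sweep_error_lt (d : ℕ) {τ ε : ℝ} (hτ : 0 ≤ τ) (hε : 0 < ε) :
    min 2 (sweepCount d τ ε * (2 * expTail (2 * d * (2 * (τ / sweepCount d τ ε))))) < ε := by
  -- The distance of two quantum operations never exceeds `2`, so that `ε < 3` may be assumed.
  rcases le_or_gt 3 ε with h3 | h3
  · exact (min_le_left _ _).trans_lt (by linarith)
  refine (min_le_right _ _).trans_lt ?_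
  have hr : 16 * (d : ℝ) ^ 2 * τ ^ (3 / 2 : ℝ) / √ε < sweepCount d τ ε := by
    rw [sweepCount, Nat.cast_add_one]
    exact (Nat.le_ceil _).trans_lt (lt_add_one _)
  have he : 0 < √ε := Real.sqrt_pos.mpr hε
  rw [div_lt_iff₀ he] at hr
  have h32 : τ ^ (3 / 2 : ℝ) = √τ ^ 3 := by
    rw [Real.sqrt_eq_rpow, ← Real.rpow_natCast, ← Real.rpow_mul hτ]
    norm_num
  rw [h32] at hr
  have := sweep_error_lt (Real.sqrt_nonneg τ) he (by rwa [Real.sq_sqrt hε.le])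
    (Nat.succ_le_succ (Nat.zero_le _)) hr
  rwa [Real.sq_sqrt hε.le, Real.sq_sqrt hτ] at this

theorem mul_sweepCount_le (d : ℕ) {τ ε : ℝ} (hτ : 0 ≤ τ) :
    (d : ℝ) * sweepCount d τ ε
      ≤ 16 * ((d : ℝ) ^ 2 + (d : ℝ) ^ 5 * τ ^ (3 / 2 : ℝ) / √ε) := by
  have hx : 0 ≤ τ ^ (3 / 2 : ℝ) / √ε := by positivity
  have h1 : (sweepCount d τ ε : ℝ) ≤ 16 * (d : ℝ) ^ 2 * (τ ^ (3 / 2 : ℝ) / √ε) + 2 := by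
    rw [sweepCount, Nat.cast_add_one, mul_div_assoc]
    have := (Nat.ceil_lt_add_one (a := 16 * (d : ℝ) ^ 2 * (τ ^ (3 / 2 : ℝ) / √ε))
      (by positivity)).le
    linarith
  rw [mul_div_assoc]
  rcases Nat.eq_zero_or_pos d with rfl | hd
  · simp
  have hd1 : (1 : ℝ) ≤ d := by exact_mod_cast hd
  have h3 : (d : ℝ) ^ 3 ≤ d ^ 5 := by
    gcongr
    norm_num
  have h4 := mul_le_mul_of_nonneg_right h3 hx
  have h5 := mul_le_mul_of_nonneg_left h1 (Nat.cast_nonneg d)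
  nlinarith

theorem width_le_three_mul_log {N : ℕ} (hN : 2 ≤ N) : (width N : ℝ) ≤ 3 * Real.log N := by
  have hw : 0 < width N := Nat.clog_pos (by norm_num) hN
  have h1 : 2 ^ (width N - 1) < N := Nat.pow_pred_clog_lt_self (by norm_num) hN
  have h2 : ((width N - 1 : ℕ) : ℝ) * Real.log 2 ≤ Real.log N := by
    rw [← Real.log_pow]
    refine Real.log_le_log (by positivity) ?_
    exact_mod_cast h1.le
  rw [Nat.cast_pred hw] at h2
  have h3 : Real.log 2 ≤ Real.log N := Real.log_le_log (by norm_num) (by exact_mod_cast hN)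
  have h4 := Real.log_two_gt_d9
  nlinarith

end Budget

/-- On a one-dimensional system the circuit without gates is exact. -/
theorem diamondNorm_channel_empty_sub_le {N d : ℕ} (hN : N = 1) {a : Matrix (Fin N) (Fin N) ℝ}
    (ha : ∀ k l, 0 ≤ a k l) (B : BlackBox a d) (t : ℝ) :
    diamondNorm ((jumpCircuit ([] : List (Fin d)) 0).channel B -
      encode N ∘ₗ evolution (lindbladian a) t) ≤ 0 := by
  subst hN
  have hg : generator a = 0 := by
    ext x y
    simp [generator, Subsingleton.elim x 0, Subsingleton.elim y 0]
  refine diamondNorm_channel_jumpCircuit_sub_le B [] le_rfl le_rfl (slotRate_nonneg B ha)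
    (fun x y h => absurd (Subsingleton.elim x y) h) fun x => ?_
  simp [hg]

end SparseLindblad

theorem mainTheorem4 :
    ∃ C : ℝ, 0 < C ∧
      ∀ (N d : ℕ) (t τ ε : ℝ), 1 ≤ N → 0 < t → 0 ≤ τ → 0 < ε →
        ∃ A : SparseLindblad.Circuit N d,
          (A.gateCount : ℝ) ≤
            C * (((d : ℝ) ^ 2 + (d : ℝ) ^ 5 * τ ^ (3 / 2 : ℝ) / √ε) * Real.log N) ∧
          (A.queryCount : ℝ) ≤ C * ((d : ℝ) ^ 2 + (d : ℝ) ^ 5 * τ ^ (3 / 2 : ℝ) / √ε) ∧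
          ∀ a : Matrix (Fin N) (Fin N) ℝ,
            (∀ k l, 0 ≤ a k l) → SparseLindblad.IsSparse d a →
            SparseLindblad.diamondNorm (SparseLindblad.lindbladian a) * t ≤ τ →
            ∀ B : SparseLindblad.BlackBox a d,
              SparseLindblad.diamondNorm
                (A.channel B -
                  SparseLindblad.encode N ∘ₗ
                    SparseLindblad.evolution (SparseLindblad.lindbladian a) t) < ε := by
  refine ⟨2500, by norm_num, fun N d t τ ε hN ht hτ hε => ?_⟩
  have hX : 0 ≤ (d : ℝ) ^ 2 + (d : ℝ) ^ 5 * τ ^ (3 / 2 : ℝ) / √ε := by positivity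
  rcases hN.eq_or_lt with hN1 | hN2
  · refine ⟨SparseLindblad.jumpCircuit [] 0, ?_, ?_, fun a ha _ _ B =>
      (SparseLindblad.diamondNorm_channel_empty_sub_le hN1.symm ha B t).trans_lt hε⟩
    · rw [SparseLindblad.gateCount_jumpCircuit]
      simp [← hN1]
    · rw [SparseLindblad.queryCount_jumpCircuit]
      simpa using hX
  · have : NeZero N := ⟨by omega⟩
    have hdr := SparseLindblad.mul_sweepCount_le d (ε := ε) hτ
    have hw := SparseLindblad.width_le_three_mul_log hN2
    have hw1 : (1 : ℝ) ≤ SparseLindblad.width N := by exact_mod_cast Nat.clog_pos (by norm_num) hN2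
    set X := (d : ℝ) ^ 2 + (d : ℝ) ^ 5 * τ ^ (3 / 2 : ℝ) / √ε
    refine ⟨SparseLindblad.jumpCircuit (SparseLindblad.sweeps d (SparseLindblad.sweepCount d τ ε))
      (t / (2 * SparseLindblad.sweepCount d τ ε)), ?_, ?_, fun a ha _ haτ B => ?_⟩
    · rw [SparseLindblad.gateCount_jumpCircuit, SparseLindblad.length_sweeps]
      push_cast
      calc (24 * (SparseLindblad.width N : ℝ) + 2) * (SparseLindblad.sweepCount d τ ε * (2 * d))
          = (24 * (SparseLindblad.width N : ℝ) + 2) * 2 *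
              (d * SparseLindblad.sweepCount d τ ε) := by ring
        _ ≤ (26 * (3 * Real.log N)) * 2 * (16 * X) := by
          gcongr
          linarith
        _ ≤ 2500 * (X * Real.log N) := by
          have : 0 ≤ X * Real.log N := mul_nonneg hX (Real.log_natCast_nonneg N)
          linarith
    · rw [SparseLindblad.queryCount_jumpCircuit, SparseLindblad.length_sweeps]
      push_cast
      linarith
    · exact (SparseLindblad.diamondNorm_channel_sweeps_sub_le B ha hN2 ht.le haτ
        (Nat.succ_ne_zero _)).trans_lt (SparseLindblad.min_two_sweep_error_lt d hτ hε)
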